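/- For non-integer real $\nu$ and $z>0$ let $$I_\nu(z)=\sum_{k\ge 0}\frac{(z/2)^{2k+\nu}}{k!\,\Gamma(k+\nu+1)},\qquad K_\nu(z)=\frac{\pi}{2}\,\frac{I_{-\nu}(z)-I_\nu(z)}{\sin \nu\pi}$$ be the modified Bessel functions, and for $z>0$ and $2\beta\notin\mathbb{Z}$ let $$\mathcal W_{\alpha,\beta}(z)=z^{\beta+1/2}e^{-z/2}\,U\left(\tfrac12-\alpha+\beta,\,2\beta+1;\,z\right)$$ be the Whittaker function, where $$U(a,b;z)=\frac{\Gamma(1-b)}{\Gamma(a-b+1)}M(a,b;z)+\frac{\Gamma(b-1)}{\Gamma(a)}z^{1-b}M(a-b+1,2-b;z),\qquad M(a,b;z)=\sum_{k\ge0}\frac{(a)_k}{(b)_k}\frac{z^k}{k!}.$$ Here "solution" means a $C^3$ function on the quadrant $\{x>0,\ t>0\}$ that satisfies the equation at every point of it, $D_t=\partial/\partial t$ and $D_x=\partial/\partial x$. (1) The function $$u_1(x,t)=\frac1\pi\sqrt{\frac xt}\;K_{1/3}\left(\frac{2}{3^{3/2}}\,\frac{x^{3/2}}{\sqrt t}\right)$$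 is a solution of $(D_t+D_x^3)u_1=0$. (2) The function $$u_2(x,t)=\frac{\sqrt3}{2\sqrt\pi\,x}\,\exp\left(\frac{2x^3}{3^3t^2}\right)\mathcal W_{-\frac12,\frac16}\left(\frac{4x^3}{3^3t^2}\right)$$ is a solution of $(D_t^2-D_x^3)u_2=0$, and for all $x,t>0$ $$u_2(x,t)=\int_0^\infty u_1(x,s)\,\frac{t\,e^{-t^2/(4s)}}{\sqrt{4\pi s^3}}\,ds,$$ where the integral converges absolutely. (3) The function $$u_3(x,t)=\frac{3^{3/2}}{2\pi}\,\frac{t}{x^2+xt+t^2}$$ and its constant multiple $\dfrac{2}{3^{3/2}\pi}\,\dfrac{t}{x^2+xt+t^2}$ are solutions of $(D_t^3+D_x^3)u=0$, and for all $x,t>0$ $$u_3(x,t)=\int_0^\infty u_1(x,s)\,\frac{1}{3\pi}\,\frac{t^{3/2}}{s^{3/2}}\,K_{1/3}\left(\frac{2}{3^{3/2}}\,\frac{t^{3/2}}{\sqrt s}\right)ds,$$ where the integral converges absolutely; moreover $u_3(x,t)=\dfrac{3^{3/2}\,t}{2\pi}\,\dfrac{x-t}{x^3-t^3}$ when $x\neq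 t$. -/

import Mathlib

open Set MeasureTheory

noncomputable section

/-- Modified Bessel function of the first kind,
`I_ν(z) = ∑ₖ (z/2)^(2k+ν) / (k! Γ(k+ν+1))`, for real order `ν` and argument `z > 0`.
(`Real.Gamma` vanishes at its poles, so that the convention `1/Γ = 0` there holds.) -/
def besselI (ν z : ℝ) : ℝ :=
  ∑' k : ℕ, (z / 2) ^ (2 * (k : ℝ) + ν) / ((k.factorial : ℝ) * Real.Gamma ((k : ℝ) + ν + 1))

/-- Modified Bessel function of the second kind (Macdonald function) of non-integer real
order `ν`, for `z > 0`. -/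
def besselK (ν z : ℝ) : ℝ :=
  Real.pi / 2 * ((besselI (-ν) z - besselI ν z) / Real.sin (ν * Real.pi))

/-- Kummer's confluent hypergeometric function of the first kind,
`M(a, b; z) = ∑ₖ (a)ₖ / (b)ₖ * z^k / k!`, for `b` not in `{0, -1, -2, …}`. -/
def kummerM (a b z : ℝ) : ℝ :=
  ∑' k : ℕ, (ascPochhammer ℝ k).eval a / (ascPochhammer ℝ k).eval b * (z ^ k / (k.factorial : ℝ))

/-- Confluent hypergeometric function of the second kind `U(a, b; z)`, for real `a`, non-integer
real `b`, and `z > 0`. -/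
def kummerU (a b z : ℝ) : ℝ :=
  Real.Gamma (1 - b) / Real.Gamma (a - b + 1) * kummerM a b z
    + Real.Gamma (b - 1) / Real.Gamma a * z ^ (1 - b) * kummerM (a - b + 1) (2 - b) z

/-- Whittaker function `𝒲_{α, β}(z)`, for `2β` not an integer and `z > 0`. -/
def whittakerW (α β z : ℝ) : ℝ :=
  z ^ (β + 1 / 2) * Real.exp (-z / 2) * kummerU (1 / 2 - α + β) (2 * β + 1) z

/-- `u₁(x,t) = (1/π) √(x/t) K_{1/3}(2 x^{3/2} / (3^{3/2} √t))`. -/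
def solU1 (x t : ℝ) : ℝ :=
  1 / Real.pi * Real.sqrt (x / t) *
    besselK (1 / 3) (2 / 3 ^ (3 / 2 : ℝ) * (x ^ (3 / 2 : ℝ) / Real.sqrt t))

/-- `u₂(x,t) = √3 / (2 √π x) * exp(2x³ / (27t²)) * 𝒲_{-1/2, 1/6}(4x³ / (27t²))`. -/
def solU2 (x t : ℝ) : ℝ :=
  Real.sqrt 3 / (2 * Real.sqrt Real.pi * x) * Real.exp (2 * x ^ 3 / (3 ^ 3 * t ^ 2)) *
    whittakerW (-1 / 2) (1 / 6) (4 * x ^ 3 / (3 ^ 3 * t ^ 2))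

/-- `u₃(x,t) = 3^{3/2} / (2π) * t / (x² + xt + t²)`. -/
def solU3 (x t : ℝ) : ℝ :=
  3 ^ (3 / 2 : ℝ) / (2 * Real.pi) * (t / (x ^ 2 + x * t + t ^ 2))

/-- `u` is a classical (`C³`) solution of `(∂ₜ^n + σ ∂ₓ³) u = 0` (with `n ≤ 3`) on the open quadrant
`x > 0`, `t > 0`. -/
def IsClassicalSolution (n : ℕ) (σ : ℝ) (u : ℝ → ℝ → ℝ) : Prop :=
  ContDiffOn ℝ 3 (fun p : ℝ × ℝ => u p.1 p.2) (Ioi 0 ×ˢ Ioi 0) ∧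
  ∀ x t : ℝ, 0 < x → 0 < t →
    iteratedDeriv n (fun τ => u x τ) t + σ * iteratedDeriv 3 (fun ξ => u ξ t) x = 0

/-- Density in `s > 0` of the stable subordinator of index `1/2` at time `t > 0`,
`t e^{-t²/(4s)} / √(4π s³)`. -/
def stableHalf (s t : ℝ) : ℝ :=
  t * Real.exp (-t ^ 2 / (4 * s)) / Real.sqrt (4 * Real.pi * s ^ 3)

/-- Density in `s > 0` of the stable subordinator of index `1/3` at time `t > 0`,
`(1/(3π)) (t^{3/2}/s^{3/2}) K_{1/3}(2 t^{3/2} / (3^{3/2} √s))`. -/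
def stableThird (s t : ℝ) : ℝ :=
  1 / (3 * Real.pi) * (t ^ (3 / 2 : ℝ) / s ^ (3 / 2 : ℝ)) *
    besselK (1 / 3) (2 / 3 ^ (3 / 2 : ℝ) * (t ^ (3 / 2 : ℝ) / Real.sqrt s))

end

/-! Everything rests on one entire function, `airyA`, written A below: a rescaled Airy function with
A'' = 9yA. Since K_{1/3} is a difference of two Bessel series, u₁(x,t) = t^{-1/3} A(x t^{-1/3}/3)
(`solU1_eq`), and the equation for u₁ becomes the derivative of A'' = 9yA.

Likewise u₂ = t^{-2/3} W(x t^{-2/3}), where W combines two Kummer series in 4y³/27 (`solU2_eq`).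
Profiles of this shape satisfy a second order ODE (`hasDerivAt_cubicProfileDeriv`), which gives the
equation for u₂. Integrating the two series of A termwise against the 1/2-stable density is a
Laplace transform in 1/s (`inverse_laplace_besselCoeff`) and produces exactly the two series of W.

For u₃, the 1/3-stable density is t/(3s) times u₁(t,s) (`stableThird_eq`), so r = s^{-1/3} turns the
integral into t ∫ r A(xr/3) A(tr/3) dr. The integrand has an explicit antiderivative of Wronskian
type (`exists_airyA_antideriv`). Positivity and decay of A, needed to integrate up to infinity, are
invisible in its power series; they come from identifying A with a multiple of ∫ exp(-v³ - y³/v³) dv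
over v > 0 (`airyA_eq_airyInt`). -/

open Filter Topology

/-! ### Entire power series and two-term recurrences. -/

/-- The sum of the power series with coefficients `c`. -/
noncomputable def powerSum (c : ℕ → ℝ) (w : ℝ) : ℝ := ∑' k, c k * w ^ k

/-- The power series with coefficients `c` converges everywhere. -/
def EntireCoeff (c : ℕ → ℝ) : Prop := ∀ w : ℝ, Summable fun k => c k * w ^ k

/-- Coefficients of the derivative of a power series. -/
def derivCoeff (c : ℕ → ℝ) (k : ℕ) : ℝ := ((k : ℝ) + 1) * c (k + 1)

lemma EntireCoeff.abs {c : ℕ → ℝ} (hc : EntireCoeff c) (w : ℝ) :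
    Summable fun k => |c k| * |w| ^ k := by
  simpa [abs_mul, abs_pow] using (hc w).abs

lemma EntireCoeff.summable_deriv {c : ℕ → ℝ} (hc : EntireCoeff c) {R : ℝ} (hR : 0 ≤ R) :
    Summable fun k : ℕ => (k : ℝ) * |c k| * R ^ (k - 1) := by
  -- The factor 2^k absorbs k, and R + 1 ≥ 1 absorbs the truncated exponent k - 1.
  have h := hc.abs (2 * (R + 1))
  refine Summable.of_nonneg_of_le (fun k => by positivity) (fun k => ?_) h
  rw [abs_of_nonneg (by positivity : 0 ≤ 2 * (R + 1))]
  have h1 : (k : ℝ) ≤ 2 ^ k := by exact_mod_cast (Nat.lt_two_pow_self).le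
  have h2 : R ^ (k - 1) ≤ (R + 1) ^ k :=
    calc R ^ (k - 1) ≤ (R + 1) ^ (k - 1) := by gcongr; linarith
      _ ≤ (R + 1) ^ k := pow_le_pow_right₀ (by linarith) (Nat.sub_le _ _)
  calc (k : ℝ) * |c k| * R ^ (k - 1) ≤ 2 ^ k * |c k| * (R + 1) ^ k := by gcongr
    _ = |c k| * (2 * (R + 1)) ^ k := by rw [mul_pow]; ring

lemma EntireCoeff.derivCoeff {c : ℕ → ℝ} (hc : EntireCoeff c) : EntireCoeff (derivCoeff c) := by
  intro w
  have h := (summable_nat_add_iff 1).2 (hc.summable_deriv (abs_nonneg w))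
  refine Summable.of_abs (h.congr fun k => ?_)
  simp only [_root_.derivCoeff, abs_mul, abs_pow, Nat.add_sub_cancel]
  rw [abs_of_nonneg (by positivity : (0 : ℝ) ≤ (k : ℝ) + 1)]
  push_cast; ring

lemma EntireCoeff.hasDerivAt {c : ℕ → ℝ} (hc : EntireCoeff c) (w : ℝ) :
    HasDerivAt (powerSum c) (powerSum (_root_.derivCoeff c) w) w := by
  have hR : 0 ≤ |w| + 1 := by positivity
  have key := hasDerivAt_tsum_of_isPreconnected (𝕜 := ℝ) (F := ℝ)
    (g := fun k z => c k * z ^ k) (g' := fun k z => c k * ((k : ℝ) * z ^ (k - 1)))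
    (hc.summable_deriv hR) Metric.isOpen_ball (convex_ball (0 : ℝ) (|w| + 1)).isPreconnected
    (fun n y _ => (hasDerivAt_pow n y).const_mul (c n))
    (fun n y hy => by
      have hy' : |y| ≤ |w| + 1 := by simpa using (mem_ball_zero_iff.1 hy).le
      rw [Real.norm_eq_abs, abs_mul, abs_mul, abs_pow, Nat.abs_cast]
      calc |c n| * (n * |y| ^ (n - 1)) = n * |c n| * |y| ^ (n - 1) := by ring
        _ ≤ _ := by gcongr)
    (y₀ := w) (by simp) (hc w) (y := w) (by simp)
  have hs : Summable fun k => c k * ((k : ℝ) * w ^ (k - 1)) := by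
    refine Summable.of_abs ((hc.summable_deriv (abs_nonneg w)).congr fun k => ?_)
    rw [abs_mul, abs_mul, abs_pow, Nat.abs_cast]; ring
  have hval : powerSum (_root_.derivCoeff c) w = ∑' k, c k * ((k : ℝ) * w ^ (k - 1)) := by
    rw [hs.tsum_eq_zero_add]
    simp only [powerSum, _root_.derivCoeff, CharP.cast_eq_zero, zero_mul, mul_zero, zero_add,
      Nat.add_sub_cancel]
    exact tsum_congr fun k => by push_cast; ring
  rw [hval]
  exact key

lemma EntireCoeff.contDiff {c : ℕ → ℝ} (hc : EntireCoeff c) (n : ℕ) :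
    ContDiff ℝ n (powerSum c) := by
  induction n generalizing c with
  | zero => exact contDiff_zero.2 (continuous_iff_continuousAt.2 fun w => (hc.hasDerivAt w).continuousAt)
  | succ n ih =>
    have hd : deriv (powerSum c) = powerSum (_root_.derivCoeff c) :=
      funext fun w => (hc.hasDerivAt w).deriv
    rw [show ((n + 1 : ℕ) : WithTop ℕ∞) = (n : WithTop ℕ∞) + 1 by push_cast; rfl,
      contDiff_succ_iff_deriv]
    exact ⟨fun w => (hc.hasDerivAt w).differentiableAt, by simp, hd ▸ ih hc.derivCoeff⟩

lemma powerSum_zero (c : ℕ → ℝ) : powerSum c 0 = c 0 := by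
  rw [powerSum, tsum_eq_single 0 (fun k hk => by simp [hk])]; simp

lemma EntireCoeff.hasSum_mul_derivCoeff {c : ℕ → ℝ} (hc : EntireCoeff c) (w : ℝ) :
    HasSum (fun k : ℕ => (k : ℝ) * c k * w ^ k) (w * powerSum (_root_.derivCoeff c) w) := by
  have h := (hc.derivCoeff w).hasSum.mul_left w
  rw [← hasSum_nat_add_iff' 1]
  simp only [Finset.range_one, Finset.sum_singleton, CharP.cast_eq_zero, zero_mul, sub_zero]
  refine h.congr_fun fun k => ?_
  simp only [_root_.derivCoeff]; push_cast; ring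

/-- Two-term recurrence of confluent hypergeometric type. -/
def HypergeometricRec (a b d : ℝ) (c : ℕ → ℝ) : Prop :=
  ∀ k : ℕ, ((k : ℝ) + 1) * (k + b) * c (k + 1) = (d * k + a) * c k

/-- As |dk + a| ≤ C(k + b) with C = |d| + |a|/b, the recurrence gives (k+1)|c(k+1)| ≤ C|c k|, so the
series is dominated by an exponential one. -/
lemma HypergeometricRec.entireCoeff {a b d : ℝ} {c : ℕ → ℝ} (h : HypergeometricRec a b d c)
    (hb : 0 < b) : EntireCoeff c := by
  set C := |d| + |a| / b with hC
  have hC0 : 0 ≤ C := by positivity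
  have hbound : ∀ k : ℕ, |c k| ≤ |c 0| * (C ^ k / k.factorial) := by
    intro k
    induction k with
    | zero => simp
    | succ k ih =>
      have hk : (0 : ℝ) < (k + 1) * (k + b) := by positivity
      have h1 : ((k : ℝ) + 1) * (k + b) * |c (k + 1)| = |d * k + a| * |c k| := by
        rw [← abs_mul, ← h k, abs_mul, abs_of_pos hk]
      have h2 : |d * k + a| ≤ C * (k + b) := by
        calc |d * k + a| ≤ |d| * k + |a| := by
              refine (abs_add_le _ _).trans ?_
              rw [abs_mul, Nat.abs_cast]
          _ ≤ C * (k + b) := by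
              have : |a| / b * b = |a| := div_mul_cancel₀ _ hb.ne'
              have h3 : 0 ≤ |a| / b * k := by positivity
              have h4 : 0 ≤ |d| * b := by positivity
              rw [hC]; nlinarith
      have h5 : ((k : ℝ) + 1) * |c (k + 1)| ≤ C * |c k| := by
        have : ((k : ℝ) + b) * (((k : ℝ) + 1) * |c (k + 1)|) ≤ (k + b) * (C * |c k|) := by
          calc _ = |d * k + a| * |c k| := by rw [← h1]; ring
            _ ≤ C * (k + b) * |c k| := by gcongr
            _ = _ := by ring
        exact le_of_mul_le_mul_left this (by positivity)
      have h6 : ((k : ℝ) + 1) * |c (k + 1)| ≤ C * (|c 0| * (C ^ k / k.factorial)) :=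
        h5.trans (by gcongr)
      rw [Nat.factorial_succ]; push_cast
      rw [← mul_le_mul_iff_right₀ (by positivity : (0 : ℝ) < k + 1)]
      refine h6.trans (le_of_eq ?_)
      field_simp
      ring
  intro w
  refine Summable.of_abs (Summable.of_nonneg_of_le (fun _ => abs_nonneg _) (fun k => ?_)
    ((Real.summable_pow_div_factorial (C * |w|)).mul_left |c 0|))
  rw [abs_mul, abs_pow]
  calc |c k| * |w| ^ k ≤ |c 0| * (C ^ k / k.factorial) * |w| ^ k := by gcongr; exact hbound k
    _ = _ := by rw [mul_pow]; ring

lemma HypergeometricRec.ode {a b d : ℝ} {c : ℕ → ℝ} (h : HypergeometricRec a b d c)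
    (hb : 0 < b) (w : ℝ) :
    w * powerSum (derivCoeff (derivCoeff c)) w + b * powerSum (derivCoeff c) w
      = d * (w * powerSum (derivCoeff c) w) + a * powerSum c w := by
  have hc := h.entireCoeff hb
  have h1 := (hc.derivCoeff.hasSum_mul_derivCoeff w).add ((hc.derivCoeff w).hasSum.mul_left b)
  have h2 := ((hc.hasSum_mul_derivCoeff w).mul_left d).add ((hc w).hasSum.mul_left a)
  refine h1.unique (h2.congr_fun fun k => ?_)
  have := h k
  simp only [derivCoeff]
  linear_combination (w ^ k) * this

/-! ### Bessel and Kummer functions as power series. -/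

lemma Real.Gamma_natCast_add {s : ℝ} (hs : 0 < s) (k : ℕ) :
    Real.Gamma (k + s) = Real.Gamma s * (ascPochhammer ℝ k).eval s := by
  induction k with
  | zero => simp
  | succ k ih =>
    rw [show ((k + 1 : ℕ) : ℝ) + s = (k + s) + 1 by push_cast; ring,
      Real.Gamma_add_one (by positivity), ih, ascPochhammer_succ_eval]
    ring

/-- Coefficients of the entire function `φ_ν` with `I_ν(z) = (z/2)^ν φ_ν(z²/4)`. -/
noncomputable def besselCoeff (ν : ℝ) (k : ℕ) : ℝ :=
  1 / ((k.factorial : ℝ) * Real.Gamma ((k : ℝ) + ν + 1))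

/-- Coefficients of Kummer's function `M(a, b; ·)`. -/
noncomputable def kummerCoeff (a b : ℝ) (k : ℕ) : ℝ :=
  (ascPochhammer ℝ k).eval a / (ascPochhammer ℝ k).eval b / (k.factorial : ℝ)

lemma besselCoeff_rec {ν : ℝ} (hν : 0 < ν + 1) : HypergeometricRec 1 (ν + 1) 0 (besselCoeff ν) := by
  intro k
  have h : (0 : ℝ) < k + ν + 1 := by rw [add_assoc]; positivity
  have hG := (Real.Gamma_pos_of_pos h).ne'
  have hf : (k.factorial : ℝ) ≠ 0 := by positivity
  simp only [besselCoeff, Nat.factorial_succ]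
  push_cast
  rw [show (k : ℝ) + 1 + ν + 1 = (k + ν + 1) + 1 by ring, Real.Gamma_add_one h.ne',
    show (k : ℝ) + (ν + 1) = k + ν + 1 by ring]
  field_simp
  ring

lemma kummerCoeff_rec (a : ℝ) {b : ℝ} (hb : 0 < b) :
    HypergeometricRec a b 1 (kummerCoeff a b) := by
  intro k
  have hA := (ascPochhammer_pos k b hb).ne'
  have hf : (k.factorial : ℝ) ≠ 0 := by positivity
  have hk : b + (k : ℝ) ≠ 0 := by positivity
  simp only [kummerCoeff, Nat.factorial_succ, ascPochhammer_succ_eval]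
  push_cast
  field_simp
  ring

lemma besselCoeff_pos {ν : ℝ} (hν : 0 < ν + 1) (k : ℕ) : 0 < besselCoeff ν k := by
  have h : (0 : ℝ) < k + ν + 1 := by rw [add_assoc]; positivity
  have := Real.Gamma_pos_of_pos h
  rw [besselCoeff]; positivity

lemma kummerM_eq_powerSum (a b : ℝ) : kummerM a b = powerSum (kummerCoeff a b) := by
  funext z
  exact tsum_congr fun k => by rw [kummerCoeff]; ring

lemma besselI_eq_powerSum (ν : ℝ) {z : ℝ} (hz : 0 < z) :
    besselI ν z = (z / 2) ^ ν * powerSum (besselCoeff ν) ((z / 2) ^ 2) := by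
  rw [besselI, powerSum, ← tsum_mul_left]
  refine tsum_congr fun k => ?_
  rw [besselCoeff, Real.rpow_add (by positivity), Real.rpow_mul (by positivity), Real.rpow_natCast]
  norm_num
  ring

/-! ### Laplace transforms of Bessel series. -/

/-- Termwise Laplace transform of `y^(μ-1) φ_ν(X y)`. -/
lemma laplace_besselCoeff {μ ν c X : ℝ} (hμ : 0 < μ) (hν : 0 < ν + 1) (hc : 0 < c) (hX : 0 < X) :
    IntegrableOn (fun y => y ^ (μ - 1) * Real.exp (-(c * y)) *
      powerSum (besselCoeff ν) (X * y)) (Ioi 0) ∧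
    ∫ y in Ioi (0 : ℝ), y ^ (μ - 1) * Real.exp (-(c * y)) * powerSum (besselCoeff ν) (X * y)
      = Real.Gamma μ / Real.Gamma (ν + 1) * (1 / c) ^ μ * kummerM μ (ν + 1) (X / c) := by
  have hGμ := Real.Gamma_pos_of_pos hμ
  have hGν := Real.Gamma_pos_of_pos hν
  set F : ℕ → ℝ → ℝ := fun k y => besselCoeff ν k * X ^ k *
    (y ^ ((k + μ) - 1) * Real.exp (-(c * y))) with hF
  have hval : ∀ k, ∫ y in Ioi (0 : ℝ), F k y =
      Real.Gamma μ / Real.Gamma (ν + 1) * (1 / c) ^ μ * (kummerCoeff μ (ν + 1) k * (X / c) ^ k) := by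
    intro k
    have hA := (ascPochhammer_pos k (ν + 1) hν).ne'
    simp only [hF]
    rw [integral_const_mul, Real.integral_rpow_mul_exp_neg_mul_Ioi (by positivity) hc,
      Real.Gamma_natCast_add hμ, Real.rpow_add (by positivity), Real.rpow_natCast, besselCoeff,
      show (k : ℝ) + ν + 1 = k + (ν + 1) by ring, Real.Gamma_natCast_add hν, kummerCoeff,
      div_pow, div_pow, one_pow]
    field_simp
  have hterm : ∀ k, 0 < kummerCoeff μ (ν + 1) k * (X / c) ^ k := by
    intro k
    have := ascPochhammer_pos k (ν + 1) hν
    have := ascPochhammer_pos k μ hμ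
    rw [kummerCoeff]; positivity
  have hKsum := (kummerCoeff_rec μ hν).entireCoeff hν (X / c)
  have hpos : ∀ k, 0 < ∫ y in Ioi (0 : ℝ), F k y := fun k => by
    rw [hval]; have := hterm k; positivity
  -- A non-integrable function has integral 0 by convention, so a nonzero value proves
  -- integrability; the same device is used for the whole sum at the end.
  have hint : ∀ k, Integrable (F k) (volume.restrict (Ioi 0)) := fun k =>
    Integrable.of_integral_ne_zero (hpos k).ne'
  have hnorm : ∀ k, ∫ y in Ioi (0 : ℝ), ‖F k y‖ = ∫ y in Ioi (0 : ℝ), F k y := fun k =>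
    setIntegral_congr_fun measurableSet_Ioi fun y hy => by
      have hy : (0 : ℝ) < y := hy
      have := besselCoeff_pos hν k
      exact Real.norm_of_nonneg (by simp only [hF]; positivity)
  have hsum : Summable fun k => ∫ y in Ioi (0 : ℝ), ‖F k y‖ := by
    simp only [hnorm, hval]
    exact hKsum.mul_left _
  have key := (hasSum_integral_of_summable_integral_norm hint hsum).tsum_eq
  have hcongr : ∫ y in Ioi (0 : ℝ), (∑' k, F k y) =
      ∫ y in Ioi (0 : ℝ), y ^ (μ - 1) * Real.exp (-(c * y)) *
        powerSum (besselCoeff ν) (X * y) :=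
    setIntegral_congr_fun measurableSet_Ioi fun y hy => by
      have hy : (0 : ℝ) < y := hy
      simp only [powerSum, ← tsum_mul_left]
      refine tsum_congr fun k => ?_
      simp only [hF]
      rw [add_sub_assoc, Real.rpow_add hy, Real.rpow_natCast, mul_pow]
      ring
  rw [hcongr] at key
  have heq : ∫ y in Ioi (0 : ℝ), y ^ (μ - 1) * Real.exp (-(c * y)) *
        powerSum (besselCoeff ν) (X * y)
      = Real.Gamma μ / Real.Gamma (ν + 1) * (1 / c) ^ μ * kummerM μ (ν + 1) (X / c) := by
    rw [← key, kummerM_eq_powerSum, powerSum, ← tsum_mul_left]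
    exact tsum_congr hval
  refine ⟨Integrable.of_integral_ne_zero ?_, heq⟩
  have hK : 0 < kummerM μ (ν + 1) (X / c) := by
    rw [kummerM_eq_powerSum]
    exact hKsum.tsum_pos (fun k => (hterm k).le) 0 (hterm 0)
  rw [heq]
  positivity

/-- The Laplace transform of `y^(μ-1) φ_ν(X y)`, in the variable `s = 1/y`. -/
lemma inverse_laplace_besselCoeff {μ ν c X : ℝ} (hμ : 0 < μ) (hν : 0 < ν + 1) (hc : 0 < c)
    (hX : 0 < X) :
    IntegrableOn (fun s => s ^ (-μ - 1) * Real.exp (-c / s) *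
      powerSum (besselCoeff ν) (X / s)) (Ioi 0) ∧
    ∫ s in Ioi (0 : ℝ), s ^ (-μ - 1) * Real.exp (-c / s) * powerSum (besselCoeff ν) (X / s)
      = Real.Gamma μ / Real.Gamma (ν + 1) * (1 / c) ^ μ * kummerM μ (ν + 1) (X / c) := by
  obtain ⟨h1, h2⟩ := laplace_besselCoeff hμ hν hc hX
  have hE : EqOn (fun s : ℝ => (|(-1 : ℝ)| * s ^ ((-1 : ℝ) - 1)) •
      ((s ^ (-1 : ℝ)) ^ (μ - 1) * Real.exp (-(c * s ^ (-1 : ℝ))) *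
        powerSum (besselCoeff ν) (X * s ^ (-1 : ℝ))))
      (fun s => s ^ (-μ - 1) * Real.exp (-c / s) * powerSum (besselCoeff ν) (X / s)) (Ioi 0) := by
    intro s hs
    have hs : (0 : ℝ) < s := hs
    simp only [smul_eq_mul, abs_neg, abs_one, one_mul]
    rw [← Real.rpow_mul hs.le, ← mul_assoc, ← mul_assoc, ← Real.rpow_add hs, Real.rpow_neg_one,
      ← div_eq_mul_inv, ← div_eq_mul_inv, neg_div]
    ring_nf
  constructor
  · rw [← integrableOn_Ioi_comp_rpow_iff _ (by norm_num : (-1 : ℝ) ≠ 0)] at h1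
    exact h1.congr_fun hE measurableSet_Ioi
  · rw [← h2]
    exact (setIntegral_congr_fun measurableSet_Ioi hE.symm).trans (integral_comp_rpow_Ioi
      (fun y => y ^ (μ - 1) * Real.exp (-(c * y)) * powerSum (besselCoeff ν) (X * y)) (by norm_num))

/-! ### Airy form of u₁ and of the 1/3-stable density. -/

/-- A multiple of the Airy function: `airyA y = 3 ^ (2 / 3) * Ai (3 ^ (2 / 3) * y)`. -/
noncomputable def airyA (y : ℝ) : ℝ :=
  powerSum (besselCoeff (-(1 / 3))) (y ^ 3) - y * powerSum (besselCoeff (1 / 3)) (y ^ 3)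

lemma sin_third_mul_pi : Real.sin (1 / 3 * Real.pi) = Real.sqrt 3 / 2 := by
  rw [show 1 / 3 * Real.pi = Real.pi / 3 by ring, Real.sin_pi_div_three]

lemma rpow_neg_third_cube {t : ℝ} (ht : 0 < t) : (t ^ (-(1 / 3) : ℝ)) ^ 3 = 1 / t := by
  rw [← Real.rpow_natCast, ← Real.rpow_mul ht.le]
  norm_num [Real.rpow_neg_one]

/-- With Y = x t^{-1/3}/3 the Bessel argument z satisfies (z/2)² = Y³, so (z/2)^{±1/3} = Y^{±1/2}.
The prefactor √(x/t) = √3 √Y t^{-1/3} then clears the half powers, and its √3 cancels against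
sin(π/3). -/
lemma solU1_eq {x t : ℝ} (hx : 0 < x) (ht : 0 < t) :
    solU1 x t = t ^ (-(1 / 3) : ℝ) * airyA (x / 3 * t ^ (-(1 / 3) : ℝ)) := by
  set r := t ^ (-(1 / 3) : ℝ) with hr
  have hr0 : 0 < r := Real.rpow_pos_of_pos ht _
  have hr3 : r ^ 3 = 1 / t := rpow_neg_third_cube ht
  set Y := x / 3 * r with hY
  have hY0 : 0 < Y := by positivity
  set z := 2 / 3 ^ (3 / 2 : ℝ) * (x ^ (3 / 2 : ℝ) / Real.sqrt t) with hz
  have hz0 : 0 < z := by positivity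
  have hsq : (z / 2) ^ 2 = Y ^ 3 := by
    have e1 : ((3 : ℝ) ^ (3 / 2 : ℝ)) ^ 2 = 27 := by
      rw [← Real.rpow_natCast, ← Real.rpow_mul (by norm_num)]; norm_num
    have e2 : (x ^ (3 / 2 : ℝ)) ^ 2 = x ^ 3 := by
      rw [← Real.rpow_natCast, ← Real.rpow_mul hx.le]; norm_num
    rw [hz, hY, mul_pow, div_pow x, hr3, div_pow, mul_pow, div_pow, div_pow, e1, e2,
      Real.sq_sqrt ht.le]
    field_simp
    norm_num
  have hzY : z / 2 = Y ^ (3 / 2 : ℝ) := by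
    have : (Y ^ (3 / 2 : ℝ)) ^ 2 = Y ^ 3 := by
      rw [← Real.rpow_natCast, ← Real.rpow_mul hY0.le]; norm_num
    exact (pow_left_inj₀ (by positivity) (by positivity) two_ne_zero).1 (hsq.trans this.symm)
  have hp : (z / 2) ^ (1 / 3 : ℝ) = Real.sqrt Y := by
    rw [hzY, ← Real.rpow_mul hY0.le, Real.sqrt_eq_rpow]; norm_num
  have hm : (z / 2) ^ (-(1 / 3) : ℝ) = (Real.sqrt Y)⁻¹ := by
    rw [Real.rpow_neg (by positivity), hp]
  have hxt : Real.sqrt (x / t) = Real.sqrt 3 * Real.sqrt Y * r := by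
    rw [Real.sqrt_eq_iff_mul_self_eq (by positivity) (by positivity)]
    symm
    calc _ = (Real.sqrt 3 * Real.sqrt 3) * (Real.sqrt Y * Real.sqrt Y) * r ^ 2 := by ring
      _ = x * r ^ 3 := by
          rw [Real.mul_self_sqrt (by norm_num), Real.mul_self_sqrt hY0.le, hY]; ring
      _ = x / t := by rw [hr3]; ring
  rw [solU1, besselK, besselI_eq_powerSum _ hz0, besselI_eq_powerSum _ hz0, hsq, hp, hm, hxt,
    sin_third_mul_pi, airyA]
  have h3 : Real.sqrt 3 ≠ 0 := by positivity
  have hYs : Real.sqrt Y ≠ 0 := by positivity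
  have hYY : Real.sqrt Y ^ 2 = Y := Real.sq_sqrt hY0.le
  have hpi := Real.pi_ne_zero
  field_simp
  rw [hYY]

lemma stableThird_eq {t s : ℝ} (ht : 0 < t) (hs : 0 < s) :
    stableThird s t = t / (3 * s) * solU1 t s := by
  have e1 : t ^ (3 / 2 : ℝ) = t * Real.sqrt t := by
    rw [show (3 / 2 : ℝ) = 1 + 1 / 2 by norm_num, Real.rpow_add ht, Real.rpow_one,
      Real.sqrt_eq_rpow]
  have e2 : s ^ (3 / 2 : ℝ) = s * Real.sqrt s := by
    rw [show (3 / 2 : ℝ) = 1 + 1 / 2 by norm_num, Real.rpow_add hs, Real.rpow_one,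
      Real.sqrt_eq_rpow]
  rw [stableThird, solU1, Real.sqrt_div ht.le]
  have : 1 / (3 * Real.pi) * (t ^ (3 / 2 : ℝ) / s ^ (3 / 2 : ℝ)) =
      t / (3 * s) * (1 / Real.pi * (Real.sqrt t / Real.sqrt s)) := by
    rw [e1, e2]
    have := Real.pi_ne_zero
    have : Real.sqrt s ≠ 0 := by positivity
    field_simp
  rw [this]
  ring

/-! ### Derivatives of self-similar functions and the ODE of cubic profiles. -/

lemma iteratedDeriv_succ_eq_of_hasDerivAt {f f' : ℝ → ℝ}
    (h : ∀ y, 0 < y → HasDerivAt f (f' y) y) (n : ℕ) {x : ℝ} (hx : 0 < x) :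
    iteratedDeriv (n + 1) f x = iteratedDeriv n f' x := by
  rw [iteratedDeriv_succ']
  apply Filter.EventuallyEq.iteratedDeriv_eq
  filter_upwards [Ioi_mem_nhds hx] with y hy
  exact (h y hy).deriv

lemma iteratedDeriv_three_eq_of_hasDerivAt {f f₁ f₂ f₃ : ℝ → ℝ}
    (h₁ : ∀ y, 0 < y → HasDerivAt f (f₁ y) y) (h₂ : ∀ y, 0 < y → HasDerivAt f₁ (f₂ y) y)
    (h₃ : ∀ y, 0 < y → HasDerivAt f₂ (f₃ y) y) {x : ℝ} (hx : 0 < x) :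
    iteratedDeriv 3 f x = f₃ x := by
  rw [iteratedDeriv_succ_eq_of_hasDerivAt h₁ 2 hx, iteratedDeriv_succ_eq_of_hasDerivAt h₂ 1 hx,
    iteratedDeriv_succ_eq_of_hasDerivAt h₃ 0 hx, iteratedDeriv_zero]

lemma IsClassicalSolution.congr {n : ℕ} {σ : ℝ} {u v : ℝ → ℝ → ℝ}
    (hv : IsClassicalSolution n σ v) (huv : ∀ x t, 0 < x → 0 < t → u x t = v x t) :
    IsClassicalSolution n σ u := by
  refine ⟨hv.1.congr fun p hp => huv _ _ hp.1 hp.2, fun x t hx ht => ?_⟩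
  have h1 : (fun τ => u x τ) =ᶠ[𝓝 t] fun τ => v x τ := by
    filter_upwards [Ioi_mem_nhds ht] with τ hτ using huv _ _ hx hτ
  have h2 : (fun ξ => u ξ t) =ᶠ[𝓝 x] fun ξ => v ξ t := by
    filter_upwards [Ioi_mem_nhds hx] with ξ hξ using huv _ _ hξ ht
  rw [h1.iteratedDeriv_eq, h2.iteratedDeriv_eq]
  exact hv.2 x t hx ht

section SelfSimilar

variable {B B₁ B₂ B₃ : ℝ → ℝ} (q κ : ℝ)

lemma contDiffOn_selfSimilar (hB : ContDiff ℝ 3 B) :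
    ContDiffOn ℝ 3 (fun p : ℝ × ℝ => p.2 ^ q * B (κ * p.1 * p.2 ^ q)) (Ioi 0 ×ˢ Ioi 0) := by
  have h : ContDiffOn ℝ 3 (fun p : ℝ × ℝ => p.2 ^ q) (Ioi 0 ×ˢ Ioi 0) := fun p hp =>
    (contDiffAt_snd.rpow_const_of_ne (ne_of_gt hp.2)).contDiffWithinAt
  exact h.mul (hB.comp_contDiffOn (((contDiffOn_const.mul contDiffOn_fst)).mul h))

lemma hasDerivAt_selfSimilar_time (h₁ : ∀ y, HasDerivAt B (B₁ y) y) (x : ℝ) {t : ℝ} (ht : 0 < t) :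
    HasDerivAt (fun τ => τ ^ q * B (κ * x * τ ^ q))
      (q * t ^ (q - 1) * (B (κ * x * t ^ q) + κ * x * t ^ q * B₁ (κ * x * t ^ q))) t := by
  have hr := Real.hasDerivAt_rpow_const (x := t) (p := q) (Or.inl ht.ne')
  have := hr.mul ((h₁ (κ * x * t ^ q)).comp t (hr.const_mul (κ * x)))
  refine this.congr_deriv ?_
  simp only [Function.comp_apply]
  ring

lemma hasDerivAt_selfSimilar_time_two (h₁ : ∀ y, HasDerivAt B (B₁ y) y)
    (h₂ : ∀ y, HasDerivAt B₁ (B₂ y) y) (x : ℝ) {t : ℝ} (ht : 0 < t) :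
    HasDerivAt (fun τ => q * τ ^ (q - 1) *
        (B (κ * x * τ ^ q) + κ * x * τ ^ q * B₁ (κ * x * τ ^ q)))
      (q * t ^ (q - 1 - 1) * ((q - 1) * (B (κ * x * t ^ q) + κ * x * t ^ q * B₁ (κ * x * t ^ q))
        + q * (κ * x * t ^ q) *
          (2 * B₁ (κ * x * t ^ q) + κ * x * t ^ q * B₂ (κ * x * t ^ q)))) t := by
  have hr := (Real.hasDerivAt_rpow_const (x := t) (p := q) (Or.inl ht.ne')).const_mul (κ * x)
  have hs := (Real.hasDerivAt_rpow_const (x := t) (p := q - 1) (Or.inl ht.ne')).const_mul q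
  -- Real powers are atoms for `ring`, so the exponent law they need is supplied by hand.
  have e : t ^ (q - 1) * t ^ (q - 1) = t ^ (q - 1 - 1) * t ^ q := by
    rw [← Real.rpow_add ht, ← Real.rpow_add ht]; ring_nf
  have := hs.mul (((h₁ (κ * x * t ^ q)).comp t hr).add (hr.mul ((h₂ (κ * x * t ^ q)).comp t hr)))
  refine this.congr_deriv ?_
  simp only [Function.comp_apply, Pi.add_apply, Pi.mul_apply]
  linear_combination (q ^ 2 * κ * x * (2 * B₁ (κ * x * t ^ q) +
    κ * x * t ^ q * B₂ (κ * x * t ^ q))) * e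

lemma iteratedDeriv_three_selfSimilar_space (h₁ : ∀ y, HasDerivAt B (B₁ y) y)
    (h₂ : ∀ y, HasDerivAt B₁ (B₂ y) y) (h₃ : ∀ y, HasDerivAt B₂ (B₃ y) y) (t : ℝ) {x : ℝ}
    (hx : 0 < x) :
    iteratedDeriv 3 (fun ξ => t ^ q * B (κ * ξ * t ^ q)) x
      = t ^ q * (κ * t ^ q) ^ 3 * B₃ (κ * x * t ^ q) := by
  have key : ∀ (C : ℝ) (D D₁ : ℝ → ℝ), (∀ y, HasDerivAt D (D₁ y) y) → ∀ y,
      HasDerivAt (fun ξ => C * D (κ * ξ * t ^ q)) (C * (κ * t ^ q) * D₁ (κ * y * t ^ q)) y := by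
    intro C D D₁ hD y
    have := ((hD (κ * y * t ^ q)).comp y
      (((hasDerivAt_id' y).const_mul κ).mul_const (t ^ q))).const_mul C
    refine this.congr_deriv ?_
    ring
  rw [iteratedDeriv_three_eq_of_hasDerivAt (fun y _ => key _ _ _ h₁ y) (fun y _ => key _ _ _ h₂ y)
    (fun y _ => key _ _ _ h₃ y) hx]
  ring

end SelfSimilar

/-- A general solution of `E'' = 3κd y² E' + 9κa y E`, see `hasDerivAt_cubicProfileDeriv`. -/
noncomputable def cubicProfile (κ α β : ℝ) (c e : ℕ → ℝ) (y : ℝ) : ℝ :=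
  α * powerSum c (κ * y ^ 3) + β * y * powerSum e (κ * y ^ 3)

/-- The derivative of `cubicProfile`. -/
noncomputable def cubicProfileDeriv (κ α β : ℝ) (c e : ℕ → ℝ) (y : ℝ) : ℝ :=
  α * (3 * κ * y ^ 2 * powerSum (derivCoeff c) (κ * y ^ 3)) +
    β * (powerSum e (κ * y ^ 3) + 3 * κ * y ^ 3 * powerSum (derivCoeff e) (κ * y ^ 3))

section CubicProfile

variable {κ α β a d : ℝ} {c e : ℕ → ℝ}

lemma EntireCoeff.hasDerivAt_comp_cube (hc : EntireCoeff c) (κ y : ℝ) :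
    HasDerivAt (fun z => powerSum c (κ * z ^ 3))
      (3 * κ * y ^ 2 * powerSum (_root_.derivCoeff c) (κ * y ^ 3)) y := by
  have := (hc.hasDerivAt (κ * y ^ 3)).comp y ((hasDerivAt_pow 3 y).const_mul κ)
  refine this.congr_deriv ?_
  norm_num; ring

lemma contDiff_cubicProfile (hc : EntireCoeff c) (he : EntireCoeff e) (n : ℕ) :
    ContDiff ℝ n (cubicProfile κ α β c e) := by
  have h : ContDiff ℝ n fun y : ℝ => κ * y ^ 3 := by fun_prop
  exact (contDiff_const.mul ((hc.contDiff n).comp h)).add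
    ((contDiff_const.mul contDiff_id).mul ((he.contDiff n).comp h))

lemma hasDerivAt_cubicProfile (hc : EntireCoeff c) (he : EntireCoeff e) (y : ℝ) :
    HasDerivAt (cubicProfile κ α β c e) (cubicProfileDeriv κ α β c e y) y := by
  have := ((hc.hasDerivAt_comp_cube κ y).const_mul α).add
    (((hasDerivAt_id' y).const_mul β).mul (he.hasDerivAt_comp_cube κ y))
  refine this.congr_deriv ?_
  rw [cubicProfileDeriv]; ring

/-- With w = κy³, (f(w))'' = 9κy (w f'' + (2/3) f') and (y g(w))'' = 9κy² (w g'' + (4/3) g'), whence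
the parameters 2/3 and 4/3. On the other side, the term 3κd y² E' acting on the factor y of y g(w)
shifts a to a + d/3. -/
lemma hasDerivAt_cubicProfileDeriv (hc : HypergeometricRec a (2 / 3) d c)
    (he : HypergeometricRec (a + d / 3) (4 / 3) d e) (y : ℝ) :
    HasDerivAt (cubicProfileDeriv κ α β c e)
      (3 * κ * d * y ^ 2 * cubicProfileDeriv κ α β c e y
        + 9 * κ * a * y * cubicProfile κ α β c e y) y := by
  have hc' := hc.entireCoeff (by norm_num)
  have he' := he.entireCoeff (by norm_num)
  have := ((((hasDerivAt_pow 2 y).const_mul (3 * κ)).mul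
      (hc'.derivCoeff.hasDerivAt_comp_cube κ y)).const_mul α).add
    (((he'.hasDerivAt_comp_cube κ y).add (((hasDerivAt_pow 3 y).const_mul (3 * κ)).mul
      (he'.derivCoeff.hasDerivAt_comp_cube κ y))).const_mul β)
  refine this.congr_deriv ?_
  have o1 := hc.ode (by norm_num) (κ * y ^ 3)
  have o2 := he.ode (by norm_num) (κ * y ^ 3)
  simp only [cubicProfile, cubicProfileDeriv]
  norm_num
  linear_combination (9 * α * κ * y) * o1 + (9 * β * κ * y ^ 2) * o2

end CubicProfile

/-! ### The equation for u₁. -/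

/-- The derivative of `airyA`. -/
noncomputable def airyADeriv : ℝ → ℝ :=
  cubicProfileDeriv 1 1 (-1) (besselCoeff (-(1 / 3))) (besselCoeff (1 / 3))

lemma airyA_eq_cubicProfile :
    airyA = cubicProfile 1 1 (-1) (besselCoeff (-(1 / 3))) (besselCoeff (1 / 3)) := by
  funext y
  simp [airyA, cubicProfile, sub_eq_add_neg]

lemma besselCoeff_rec_neg_third : HypergeometricRec 1 (2 / 3) 0 (besselCoeff (-(1 / 3))) := by
  convert besselCoeff_rec (ν := -(1 / 3)) (by norm_num) using 1; norm_num

lemma besselCoeff_rec_third : HypergeometricRec 1 (4 / 3) 0 (besselCoeff (1 / 3)) := by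
  convert besselCoeff_rec (ν := 1 / 3) (by norm_num) using 1; norm_num

lemma contDiff_airyA (n : ℕ) : ContDiff ℝ n airyA := by
  rw [airyA_eq_cubicProfile]
  exact contDiff_cubicProfile (besselCoeff_rec_neg_third.entireCoeff (by norm_num))
    (besselCoeff_rec_third.entireCoeff (by norm_num)) n

lemma hasDerivAt_airyA (y : ℝ) : HasDerivAt airyA (airyADeriv y) y := by
  rw [airyA_eq_cubicProfile]
  exact hasDerivAt_cubicProfile (besselCoeff_rec_neg_third.entireCoeff (by norm_num))
    (besselCoeff_rec_third.entireCoeff (by norm_num)) y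

lemma hasDerivAt_airyADeriv (y : ℝ) : HasDerivAt airyADeriv (9 * y * airyA y) y := by
  rw [airyA_eq_cubicProfile]
  refine (hasDerivAt_cubicProfileDeriv besselCoeff_rec_neg_third
    (by simpa using besselCoeff_rec_third) y).congr_deriv ?_
  ring

lemma rpow_sub_one_eq {t : ℝ} (ht : 0 < t) (q : ℝ) : t ^ (q - 1) = t ^ q / t := by
  rw [Real.rpow_sub ht, Real.rpow_one]

/-- From A'' = 9yA follows A''' = 9(A + yA'), and A + yA' is also what the time derivative of
t^{-1/3} A(x t^{-1/3}/3) produces. -/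
theorem isClassicalSolution_solU1 : IsClassicalSolution 1 1 solU1 := by
  have hv : IsClassicalSolution 1 1
      (fun x t => t ^ (-(1 / 3) : ℝ) * airyA (1 / 3 * x * t ^ (-(1 / 3) : ℝ))) := by
    refine ⟨contDiffOn_selfSimilar _ _ (contDiff_airyA 3), fun x t hx ht => ?_⟩
    have h3 : ∀ y, HasDerivAt (fun y => 9 * y * airyA y) (9 * airyA y + 9 * y * airyADeriv y) y := by
      intro y
      have := ((hasDerivAt_id' y).const_mul 9).mul (hasDerivAt_airyA y)
      refine this.congr_deriv ?_
      ring
    rw [iteratedDeriv_three_selfSimilar_space _ _ hasDerivAt_airyA hasDerivAt_airyADeriv h3 t hx,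
      iteratedDeriv_one, (hasDerivAt_selfSimilar_time _ _ hasDerivAt_airyA x ht).deriv,
      rpow_sub_one_eq ht, mul_pow, rpow_neg_third_cube ht]
    field_simp
    ring
  exact hv.congr fun x t hx ht => by rw [solU1_eq hx ht]; ring_nf

/-! ### The Whittaker solution u₂ and its subordination integral. -/

/-- The profile of the self-similar function `solU2`. -/
noncomputable def whittakerProfile : ℝ → ℝ :=
  cubicProfile (4 / 27)
    (1 / Real.sqrt Real.pi * (2 ^ (2 / 3 : ℝ) * (Real.Gamma (5 / 6) / Real.Gamma (2 / 3))))
    (-(1 / Real.sqrt Real.pi * (2 ^ (4 / 3 : ℝ) / 3 * (Real.Gamma (7 / 6) / Real.Gamma (4 / 3)))))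
    (kummerCoeff (5 / 6) (2 / 3)) (kummerCoeff (7 / 6) (4 / 3))

lemma Gamma_third_mul : Real.Gamma (1 / 3) * Real.Gamma (2 / 3) = 2 * Real.pi / Real.sqrt 3 := by
  have := Real.Gamma_mul_Gamma_one_sub (1 / 3)
  rw [show (1 : ℝ) - 1 / 3 = 2 / 3 by norm_num, mul_comm Real.pi, sin_third_mul_pi] at this
  rw [this]; field_simp

lemma Gamma_five_sixths_mul : Real.Gamma (5 / 6) * Real.Gamma (7 / 6) = Real.pi / 3 := by
  have := Real.Gamma_mul_Gamma_one_sub (1 / 6)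
  rw [show (1 : ℝ) - 1 / 6 = 5 / 6 by norm_num, show Real.pi * (1 / 6) = Real.pi / 6 by ring,
    Real.sin_pi_div_six] at this
  have h := Real.Gamma_add_one (s := 1 / 6) (by norm_num)
  rw [show (1 : ℝ) / 6 + 1 = 7 / 6 by norm_num] at h
  rw [h]
  linear_combination (1 / 6) * this

lemma Gamma_four_thirds : Real.Gamma (4 / 3) = Real.Gamma (1 / 3) / 3 := by
  have h := Real.Gamma_add_one (s := 1 / 3) (by norm_num)
  rw [show (1 : ℝ) / 3 + 1 = 4 / 3 by norm_num] at h
  rw [h]; ring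

lemma Gamma_neg_third : Real.Gamma (-(1 / 3)) = -3 * Real.Gamma (2 / 3) := by
  have h := Real.Gamma_add_one (s := -(1 / 3)) (by norm_num)
  rw [show -((1 : ℝ) / 3) + 1 = 2 / 3 by norm_num] at h
  rw [h]; ring

/-- The exponentials cancel and the two terms of U give the two Kummer series. The profile carries
the Gamma quotients produced by the Laplace transform; √3 Γ(1/3)Γ(2/3) = 6 Γ(5/6)Γ(7/6), both equal
to 2π, converts the Whittaker ones into these. -/
lemma solU2_eq {x t : ℝ} (hx : 0 < x) (ht : 0 < t) :
    solU2 x t = t ^ (-(2 / 3) : ℝ) * whittakerProfile (x * t ^ (-(2 / 3) : ℝ)) := by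
  set r := t ^ (-(2 / 3) : ℝ) with hr
  have hr0 : 0 < r := Real.rpow_pos_of_pos ht _
  have hr3 : r ^ 3 = 1 / t ^ 2 := by
    rw [hr, ← Real.rpow_natCast, ← Real.rpow_mul ht.le, one_div, ← Real.rpow_natCast t,
      ← Real.rpow_neg ht.le]
    norm_num
  set Y := x * r with hY
  have hY0 : 0 < Y := by positivity
  have hz : 4 * x ^ 3 / (3 ^ 3 * t ^ 2) = 4 / 27 * Y ^ 3 := by
    rw [hY, mul_pow, hr3]; field_simp; norm_num
  have hz2 : 2 * x ^ 3 / (3 ^ 3 * t ^ 2) = 2 / 27 * Y ^ 3 := by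
    rw [hY, mul_pow, hr3]; field_simp; norm_num
  -- All fractional powers of 2 become powers of D with D³ = 2; for instance z^{1/3} = D²Y/3.
  set D : ℝ := 2 ^ (1 / 3 : ℝ) with hD
  have hD0 : 0 < D := by positivity
  have hD3 : D ^ 3 = 2 := by
    rw [hD, ← Real.rpow_natCast, ← Real.rpow_mul (by norm_num)]; norm_num
  have hD2 : (2 : ℝ) ^ (2 / 3 : ℝ) = D ^ 2 := by
    rw [hD, ← Real.rpow_natCast, ← Real.rpow_mul (by norm_num)]; norm_num
  have hD4 : (2 : ℝ) ^ (4 / 3 : ℝ) = D ^ 4 := by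
    rw [hD, ← Real.rpow_natCast, ← Real.rpow_mul (by norm_num)]; norm_num
  set z := 4 / 27 * Y ^ 3 with hzdef
  have hz0 : 0 < z := by positivity
  have hzr : z ^ (1 / 3 : ℝ) = D ^ 2 * Y / 3 := by
    have : z = (D ^ 2 * Y / 3) ^ 3 := by
      rw [hzdef]; linear_combination (-(1 / 27) * Y ^ 3 * (D ^ 3 + 2)) * hD3
    rw [this, ← Real.rpow_natCast, ← Real.rpow_mul (by positivity)]; norm_num
  have hz23 : z ^ (2 / 3 : ℝ) = (D ^ 2 * Y / 3) ^ 2 := by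
    rw [← hzr, ← Real.rpow_natCast, ← Real.rpow_mul hz0.le]; norm_num
  have hzm : z ^ (-(1 / 3) : ℝ) = (D ^ 2 * Y / 3)⁻¹ := by rw [Real.rpow_neg hz0.le, hzr]
  have hexp : Real.exp (2 / 27 * Y ^ 3) * Real.exp (-z / 2) = 1 := by
    rw [← Real.exp_add, hzdef, ← Real.exp_zero]; ring_nf
  have hU : kummerU (7 / 6) (4 / 3) z = -3 * Real.Gamma (2 / 3) / Real.Gamma (5 / 6) *
      kummerM (7 / 6) (4 / 3) z + Real.Gamma (1 / 3) / Real.Gamma (7 / 6) * (D ^ 2 * Y / 3)⁻¹ *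
        kummerM (5 / 6) (2 / 3) z := by
    rw [kummerU, ← hzm, ← Gamma_neg_third]; norm_num
  have hW : whittakerW (-1 / 2) (1 / 6) z =
      (D ^ 2 * Y / 3) ^ 2 * Real.exp (-z / 2) * kummerU (7 / 6) (4 / 3) z := by
    rw [whittakerW, ← hz23]; norm_num
  have hg1 : Real.Gamma (1 / 3) ≠ 0 := (Real.Gamma_pos_of_pos (by norm_num)).ne'
  have hg2 : Real.Gamma (2 / 3) ≠ 0 := (Real.Gamma_pos_of_pos (by norm_num)).ne'
  have hh1 : Real.Gamma (5 / 6) ≠ 0 := (Real.Gamma_pos_of_pos (by norm_num)).ne'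
  have hh2 : Real.Gamma (7 / 6) ≠ 0 := (Real.Gamma_pos_of_pos (by norm_num)).ne'
  have hpi : Real.sqrt Real.pi ≠ 0 := by have := Real.pi_pos; positivity
  have h3 : Real.sqrt 3 ≠ 0 := by positivity
  have key : Real.sqrt 3 * (Real.Gamma (1 / 3) * Real.Gamma (2 / 3)) =
      6 * (Real.Gamma (5 / 6) * Real.Gamma (7 / 6)) := by
    rw [Gamma_third_mul, Gamma_five_sixths_mul]; field_simp; norm_num
  have k1 : Real.sqrt 3 * Real.Gamma (1 / 3) / Real.Gamma (7 / 6) =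
      6 * (Real.Gamma (5 / 6) / Real.Gamma (2 / 3)) := by
    field_simp; linear_combination key
  have k2 : Real.sqrt 3 * Real.Gamma (2 / 3) / Real.Gamma (5 / 6) =
      6 * (Real.Gamma (7 / 6) / Real.Gamma (1 / 3)) := by
    field_simp; linear_combination key
  have hx' : x = Y / r := by rw [hY]; field_simp
  rw [solU2, hz, hz2, hW, hU, whittakerProfile, cubicProfile, Gamma_four_thirds,
    ← kummerM_eq_powerSum, ← kummerM_eq_powerSum, hD2, hD4, hx', ← hzdef]
  generalize kummerM (7 / 6) (4 / 3) z = M1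
  generalize kummerM (5 / 6) (2 / 3) z = M2
  have e1 : Real.sqrt 3 / (2 * Real.sqrt Real.pi * (Y / r)) * Real.exp (2 / 27 * Y ^ 3) *
      ((D ^ 2 * Y / 3) ^ 2 * Real.exp (-z / 2) *
        (-3 * Real.Gamma (2 / 3) / Real.Gamma (5 / 6) * M1 +
          Real.Gamma (1 / 3) / Real.Gamma (7 / 6) * (D ^ 2 * Y / 3)⁻¹ * M2)) =
      (Real.exp (2 / 27 * Y ^ 3) * Real.exp (-z / 2)) * (r / Real.sqrt Real.pi *
        ((Real.sqrt 3 * Real.Gamma (1 / 3) / Real.Gamma (7 / 6)) * (D ^ 2 / 6) * M2 -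
        (Real.sqrt 3 * Real.Gamma (2 / 3) / Real.Gamma (5 / 6)) * (D ^ 4 / 6) * Y * M1)) := by
    field_simp
    ring
  rw [e1, hexp, k1, k2]
  field_simp
  ring

/-- The profile satisfies W'' = (4/9)Y²W' + (10/9)YW. Differentiated once, this makes D_x³u equal to
t^{-8/3}((4/9)Y²W'' + 2YW' + (10/9)W), which is D_t²u, with Y = x t^{-2/3}. -/
theorem isClassicalSolution_solU2 : IsClassicalSolution 2 (-1) solU2 := by
  have hc : HypergeometricRec (5 / 6) (2 / 3) 1 (kummerCoeff (5 / 6) (2 / 3)) :=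
    kummerCoeff_rec _ (by norm_num)
  have he : HypergeometricRec (5 / 6 + 1 / 3) (4 / 3) 1 (kummerCoeff (7 / 6) (4 / 3)) := by
    convert kummerCoeff_rec (7 / 6) (b := 4 / 3) (by norm_num) using 1; norm_num
  have hc' := hc.entireCoeff (by norm_num)
  have he' := he.entireCoeff (by norm_num)
  have h1 : ∀ y, HasDerivAt whittakerProfile _ y := hasDerivAt_cubicProfile hc' he'
  have h2 := fun y => hasDerivAt_cubicProfileDeriv (κ := 4 / 27)
    (α := 1 / Real.sqrt Real.pi * (2 ^ (2 / 3 : ℝ) * (Real.Gamma (5 / 6) / Real.Gamma (2 / 3))))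
    (β := -(1 / Real.sqrt Real.pi *
      (2 ^ (4 / 3 : ℝ) / 3 * (Real.Gamma (7 / 6) / Real.Gamma (4 / 3))))) hc he y
  -- From here on only the ODE of the profile is used, so its derivative becomes opaque.
  generalize hB1 : cubicProfileDeriv _ _ _ _ _ = B₁ at h1 h2
  change ∀ y, HasDerivAt B₁ (3 * (4 / 27) * 1 * y ^ 2 * B₁ y +
    9 * (4 / 27) * (5 / 6) * y * whittakerProfile y) y at h2
  have hv : IsClassicalSolution 2 (-1)
      (fun x t => t ^ (-(2 / 3) : ℝ) * whittakerProfile (1 * x * t ^ (-(2 / 3) : ℝ))) := by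
    refine ⟨contDiffOn_selfSimilar _ _ (contDiff_cubicProfile hc' he' 3), fun x t hx ht => ?_⟩
    have h3 := fun y => ((((hasDerivAt_pow 2 y).const_mul (3 * (4 / 27) * 1)).mul (h2 y)).add
      (((hasDerivAt_id' y).const_mul (9 * (4 / 27) * (5 / 6))).mul (h1 y)))
    rw [iteratedDeriv_three_selfSimilar_space _ _ h1 h2 h3 t hx,
      iteratedDeriv_succ_eq_of_hasDerivAt
        (fun τ hτ => hasDerivAt_selfSimilar_time _ _ h1 x hτ) 1 ht, iteratedDeriv_one,
      (hasDerivAt_selfSimilar_time_two _ _ h1 h2 x ht).deriv,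
      rpow_sub_one_eq ht, rpow_sub_one_eq ht]
    have hr3 : (t ^ (-(2 / 3) : ℝ)) ^ 3 = 1 / t ^ 2 := by
      rw [← Real.rpow_natCast, ← Real.rpow_mul ht.le, one_div, ← Real.rpow_natCast t,
        ← Real.rpow_neg ht.le]
      norm_num
    rw [one_mul (t ^ (-(2 / 3) : ℝ)), hr3]
    generalize 1 * x * t ^ (-(2 / 3) : ℝ) = Y
    norm_num
    field_simp
    ring
  exact hv.congr fun x t hx ht => by rw [solU2_eq hx ht, one_mul]

/-- The two series of A give inverse Laplace integrals with c = t²/4, X = x³/27 and μ = 5/6, 7/6;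
X/c is the Whittaker argument 4x³/(27t²). -/
theorem solU2_eq_integral {x t : ℝ} (hx : 0 < x) (ht : 0 < t) :
    IntegrableOn (fun s => solU1 x s * stableHalf s t) (Ioi 0) ∧
      solU2 x t = ∫ s in Ioi (0 : ℝ), solU1 x s * stableHalf s t := by
  have hX : 0 < x ^ 3 / 27 := by positivity
  have hc : 0 < t ^ 2 / 4 := by positivity
  obtain ⟨i1, v1⟩ := inverse_laplace_besselCoeff (μ := 5 / 6) (ν := -(1 / 3)) (by norm_num)
    (by norm_num) hc hX
  obtain ⟨i2, v2⟩ := inverse_laplace_besselCoeff (μ := 7 / 6) (ν := 1 / 3) (by norm_num)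
    (by norm_num) hc hX
  have hE : EqOn (fun s => t / (2 * Real.sqrt Real.pi) *
      (s ^ (-(5 / 6) - 1 : ℝ) * Real.exp (-(t ^ 2 / 4) / s) *
          powerSum (besselCoeff (-(1 / 3))) (x ^ 3 / 27 / s)
        - x / 3 * (s ^ (-(7 / 6) - 1 : ℝ) * Real.exp (-(t ^ 2 / 4) / s) *
          powerSum (besselCoeff (1 / 3)) (x ^ 3 / 27 / s))))
      (fun s => solU1 x s * stableHalf s t) (Ioi 0) := by
    intro s hs
    have hs : (0 : ℝ) < s := hs
    simp only
    have e1 : (x / 3 * s ^ (-(1 / 3) : ℝ)) ^ 3 = x ^ 3 / 27 / s := by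
      rw [mul_pow, rpow_neg_third_cube hs]; ring
    have e2 : Real.sqrt (4 * Real.pi * s ^ 3) = 2 * Real.sqrt Real.pi * s ^ (3 / 2 : ℝ) := by
      rw [Real.sqrt_mul (by positivity), Real.sqrt_mul (by norm_num),
        show (4 : ℝ) = 2 ^ 2 by norm_num, Real.sqrt_sq (by norm_num), Real.sqrt_eq_rpow (s ^ 3),
        ← Real.rpow_natCast, ← Real.rpow_mul hs.le]
      norm_num
    have e3 : s ^ (-(5 / 6) - 1 : ℝ) = s ^ (-(1 / 3) : ℝ) / s ^ (3 / 2 : ℝ) := by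
      rw [← Real.rpow_sub hs]; norm_num
    have e4 : s ^ (-(7 / 6) - 1 : ℝ) = s ^ (-(1 / 3) : ℝ) * s ^ (-(1 / 3) : ℝ) / s ^ (3 / 2 : ℝ) := by
      rw [← Real.rpow_add hs, ← Real.rpow_sub hs]; norm_num
    have e5 : -(t ^ 2 / 4) / s = -t ^ 2 / (4 * s) := by field_simp
    rw [solU1_eq hx hs, stableHalf, airyA, e1, e2, e3, e4, e5]
    have := Real.sqrt_ne_zero'.2 Real.pi_pos
    have : s ^ (3 / 2 : ℝ) ≠ 0 := by positivity
    field_simp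
  have hint := (i1.sub (i2.const_mul (x / 3))).const_mul (t / (2 * Real.sqrt Real.pi))
  refine ⟨IntegrableOn.congr_fun hint hE measurableSet_Ioi, ?_⟩
  rw [← setIntegral_congr_fun measurableSet_Ioi hE, integral_const_mul,
    integral_sub i1 (i2.const_mul _), integral_const_mul, v1, v2, solU2_eq hx ht]
  set D : ℝ := 2 ^ (1 / 3 : ℝ) with hD
  have hD3 : D ^ 3 = 2 := by
    rw [hD, ← Real.rpow_natCast, ← Real.rpow_mul (by norm_num)]; norm_num
  have hD2 : (2 : ℝ) ^ (2 / 3 : ℝ) = D ^ 2 := by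
    rw [hD, ← Real.rpow_natCast, ← Real.rpow_mul (by norm_num)]; norm_num
  have hD4 : (2 : ℝ) ^ (4 / 3 : ℝ) = D ^ 4 := by
    rw [hD, ← Real.rpow_natCast, ← Real.rpow_mul (by norm_num)]; norm_num
  set r := t ^ (-(2 / 3) : ℝ) with hr
  have hr3 : r ^ 3 = 1 / t ^ 2 := by
    rw [hr, ← Real.rpow_natCast, ← Real.rpow_mul ht.le, one_div, ← Real.rpow_natCast t,
      ← Real.rpow_neg ht.le]
    norm_num
  have hc2 : ∀ p : ℝ, (1 / (t ^ 2 / 4)) ^ p = 2 ^ (2 * p) * t ^ (-(2 * p)) := by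
    intro p
    rw [show 1 / (t ^ 2 / 4) = (2 / t) ^ (2 : ℝ) by rw [Real.rpow_two]; field_simp; norm_num,
      ← Real.rpow_mul (by positivity), Real.div_rpow (by norm_num) ht.le, Real.rpow_neg ht.le]
    rfl
  have p1 : (1 / (t ^ 2 / 4)) ^ (5 / 6 : ℝ) = 2 * D ^ 2 * (r / t) := by
    rw [hc2, ← hD2, hr, ← rpow_sub_one_eq ht,
      show (2 : ℝ) * (5 / 6) = 1 + 2 / 3 by norm_num, Real.rpow_add (by norm_num), Real.rpow_one]
    norm_num
  have p2 : (1 / (t ^ 2 / 4)) ^ (7 / 6 : ℝ) = 2 * D ^ 4 * (r * r / t) := by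
    rw [hc2, ← hD4, hr, ← Real.rpow_add ht, ← rpow_sub_one_eq ht,
      show (2 : ℝ) * (7 / 6) = 1 + 4 / 3 by norm_num, Real.rpow_add (by norm_num), Real.rpow_one]
    norm_num
  have hz : x ^ 3 / 27 / (t ^ 2 / 4) = 4 / 27 * (x * r) ^ 3 := by
    rw [mul_pow, hr3]; field_simp
  rw [p1, p2, hz, whittakerProfile, cubicProfile, hD2, hD4, ← kummerM_eq_powerSum,
    ← kummerM_eq_powerSum, show -(1 / 3) + (1 : ℝ) = 2 / 3 by norm_num,
    show 1 / 3 + (1 : ℝ) = 4 / 3 by norm_num]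
  have := Real.sqrt_ne_zero'.2 Real.pi_pos
  have hg1 : Real.Gamma (4 / 3) ≠ 0 := (Real.Gamma_pos_of_pos (by norm_num)).ne'
  have hg2 : Real.Gamma (2 / 3) ≠ 0 := (Real.Gamma_pos_of_pos (by norm_num)).ne'
  field_simp
  ring

/-! ### Integral representation of A: positivity and decay. -/

/-- `∫ v^m exp(-v³ - y³/v³) dv` over `v > 0`; for `m = 0` a multiple of the Airy function. -/
noncomputable def airyInt (m : ℕ) (y : ℝ) : ℝ :=
  ∫ v in Ioi (0 : ℝ), v ^ m * Real.exp (-v ^ 3 - y ^ 3 / v ^ 3)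

lemma measurable_airyIntegrand (m : ℕ) (y : ℝ) :
    Measurable fun v : ℝ => v ^ m * Real.exp (-v ^ 3 - y ^ 3 / v ^ 3) := by fun_prop

lemma integrableOn_pow_mul_exp_neg_cube (m : ℕ) :
    IntegrableOn (fun v : ℝ => v ^ m * Real.exp (-v ^ 3)) (Ioi 0) := by
  have h := integrableOn_rpow_mul_exp_neg_mul_rpow (s := m) (p := 3) (b := 1)
    (by have : (0 : ℝ) ≤ m := by positivity
        linarith) (by norm_num) (by norm_num)
  refine h.congr_fun (fun v _ => ?_) measurableSet_Ioi
  simp only [Real.rpow_natCast]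
  rw [show (3 : ℝ) = ((3 : ℕ) : ℝ) by norm_num, Real.rpow_natCast]
  ring_nf

lemma airyInt_zero (m : ℕ) : airyInt m 0 = Real.Gamma ((m + 1) / 3) / 3 := by
  have h := integral_rpow_mul_exp_neg_mul_rpow (q := m) (p := 3) (b := 1) (by norm_num)
    (by have : (0 : ℝ) ≤ m := by positivity
        linarith) (by norm_num)
  rw [Real.one_rpow] at h
  rw [airyInt, show Real.Gamma ((m + 1) / 3) / 3 = 1 * (1 / 3) * Real.Gamma ((m + 1) / 3) by ring,
    ← h]
  refine setIntegral_congr_fun measurableSet_Ioi fun v _ => ?_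
  simp only [Real.rpow_natCast]
  rw [show (3 : ℝ) = ((3 : ℕ) : ℝ) by norm_num, Real.rpow_natCast]
  norm_num

lemma exp_airyPhase_le {v y : ℝ} (hv : 0 < v) (hy : 0 ≤ y) :
    Real.exp (-v ^ 3 - y ^ 3 / v ^ 3) ≤ Real.exp (-v ^ 3) := by
  apply Real.exp_le_exp.2
  have : 0 ≤ y ^ 3 / v ^ 3 := by positivity
  linarith

lemma integrableOn_airyIntegrand (m : ℕ) {y : ℝ} (hy : 0 ≤ y) :
    IntegrableOn (fun v : ℝ => v ^ m * Real.exp (-v ^ 3 - y ^ 3 / v ^ 3)) (Ioi 0) := by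
  refine Integrable.mono' (integrableOn_pow_mul_exp_neg_cube m)
    (measurable_airyIntegrand m y).aestronglyMeasurable ?_
  filter_upwards [ae_restrict_mem measurableSet_Ioi] with v hv
  have hv : (0 : ℝ) < v := hv
  rw [Real.norm_of_nonneg (by positivity)]
  have := exp_airyPhase_le hv hy
  gcongr

lemma airyInt_pos (m : ℕ) {y : ℝ} (hy : 0 ≤ y) : 0 < airyInt m y := by
  rw [airyInt, setIntegral_pos_iff_support_of_nonneg_ae]
  · have : Ioi (0 : ℝ) ⊆ Function.support
        (fun v : ℝ => v ^ m * Real.exp (-v ^ 3 - y ^ 3 / v ^ 3)) ∩ Ioi 0 := fun v hv => by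
      have hv' : (0 : ℝ) < v := hv
      exact ⟨ne_of_gt (by positivity), hv⟩
    refine lt_of_lt_of_le ?_ (measure_mono this)
    simp
  · filter_upwards [ae_restrict_mem measurableSet_Ioi] with v hv
    have hv : (0 : ℝ) < v := hv
    simp only [Pi.zero_apply]
    positivity
  · exact integrableOn_airyIntegrand m hy

/-- Only the limit from the right is meaningful: for y < 0 the integrand blows up at v = 0 and the
integral takes its default value. -/
lemma tendsto_airyInt_zero (m : ℕ) : Tendsto (airyInt m) (𝓝[>] 0) (𝓝 (airyInt m 0)) := by
  refine tendsto_integral_filter_of_dominated_convergence (fun v : ℝ => v ^ m * Real.exp (-v ^ 3))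
    (Eventually.of_forall fun y => (measurable_airyIntegrand m y).aestronglyMeasurable) ?_
    (integrableOn_pow_mul_exp_neg_cube m) ?_
  · filter_upwards [self_mem_nhdsWithin] with y hy
    have hy : (0 : ℝ) < y := hy
    filter_upwards [ae_restrict_mem measurableSet_Ioi] with v hv
    have hv : (0 : ℝ) < v := hv
    rw [Real.norm_of_nonneg (by positivity)]
    have := exp_airyPhase_le hv hy.le
    gcongr
  · filter_upwards with v
    have : Continuous fun y : ℝ => v ^ m * Real.exp (-v ^ 3 - y ^ 3 / v ^ 3) := by fun_prop
    exact this.continuousAt.tendsto.mono_left nhdsWithin_le_nhds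

lemma mul_exp_neg_le_one {u : ℝ} : u * Real.exp (-u) ≤ 1 := by
  have h := Real.add_one_le_exp u
  rw [Real.exp_neg, ← div_eq_mul_inv, div_le_one (Real.exp_pos u)]
  linarith

/-- Differentiation brings down 3z²/v³, singular at v = 0. Writing it as (3/z)u with u = z³/v³, the
bound u e^{-u} ≤ 1 and z > y/2 leave the dominating constant 6/y. -/
lemma hasDerivAt_airyInt (m : ℕ) {y : ℝ} (hy : 0 < y) :
    HasDerivAt (airyInt m)
      (∫ v in Ioi (0 : ℝ), v ^ m * (Real.exp (-v ^ 3 - y ^ 3 / v ^ 3) * -(3 * y ^ 2 / v ^ 3))) y := by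
  refine (hasDerivAt_integral_of_dominated_loc_of_deriv_le (𝕜 := ℝ) (s := Ioi (y / 2))
    (F' := fun z v => v ^ m * (Real.exp (-v ^ 3 - z ^ 3 / v ^ 3) * -(3 * z ^ 2 / v ^ 3)))
    (bound := fun v => 6 / y * (v ^ m * Real.exp (-v ^ 3)))
    (Ioi_mem_nhds (by linarith))
    (Eventually.of_forall fun z => (measurable_airyIntegrand m z).aestronglyMeasurable)
    (integrableOn_airyIntegrand m hy.le) ?_ ?_
    ((integrableOn_pow_mul_exp_neg_cube m).const_mul _) ?_).2
  · exact Measurable.aestronglyMeasurable (by fun_prop)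
  · filter_upwards [ae_restrict_mem measurableSet_Ioi] with v hv z hz
    have hv : (0 : ℝ) < v := hv
    have hz' : y / 2 < z := hz
    have hz0 : 0 < z := by linarith
    rw [norm_mul, norm_mul, norm_neg, Real.norm_of_nonneg (by positivity),
      Real.norm_of_nonneg (by positivity), Real.norm_of_nonneg (by positivity),
      show -v ^ 3 - z ^ 3 / v ^ 3 = -v ^ 3 + -(z ^ 3 / v ^ 3) by ring, Real.exp_add]
    have h1 := mul_exp_neg_le_one (u := z ^ 3 / v ^ 3)
    have h2 : 3 / z ≤ 6 / y := by
      rw [div_le_div_iff₀ hz0 hy]; linarith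
    calc v ^ m * (Real.exp (-v ^ 3) * Real.exp (-(z ^ 3 / v ^ 3)) * (3 * z ^ 2 / v ^ 3))
        = 3 / z * (v ^ m * Real.exp (-v ^ 3)) * (z ^ 3 / v ^ 3 * Real.exp (-(z ^ 3 / v ^ 3))) := by
          field_simp
      _ ≤ 6 / y * (v ^ m * Real.exp (-v ^ 3)) * 1 := by gcongr
      _ = _ := mul_one _
  · filter_upwards with v z _
    have := ((((hasDerivAt_pow 3 z).div_const (v ^ 3)).const_sub (-v ^ 3)).exp).const_mul (v ^ m)
    exact this.congr_deriv (by norm_num)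

/-- The substitution `v ↦ y / v` on the positive half-line. -/
lemma integral_Ioi_comp_const_div (g : ℝ → ℝ) {y : ℝ} (hy : 0 < y) :
    ∫ v in Ioi (0 : ℝ), y / v ^ 2 * g (y / v) = ∫ v in Ioi (0 : ℝ), g v := by
  have h1 := integral_comp_mul_left_Ioi g 0 hy
  have h2 := integral_comp_rpow_Ioi (fun v => g (y * v)) (p := -1) (by norm_num)
  rw [mul_zero] at h1
  have h3 : ∫ v in Ioi (0 : ℝ), g v = y * ∫ v in Ioi (0 : ℝ), g (y * v) := by
    rw [h1, smul_eq_mul]; field_simp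
  rw [h3, ← h2, ← integral_const_mul]
  refine setIntegral_congr_fun measurableSet_Ioi fun v hv => ?_
  have hv : (0 : ℝ) < v := hv
  simp only [smul_eq_mul, abs_neg, abs_one, one_mul]
  rw [Real.rpow_neg_one, show (-1 : ℝ) - 1 = -(2 : ℕ) by norm_num, Real.rpow_neg hv.le,
    Real.rpow_natCast]
  ring_nf

/-- The substitution v ↦ y/v swaps v³ and y³/v³, so it preserves the exponential and only changes
the power of v. With the next lemma, `airyInt 0` satisfies the ODE of A. -/
lemma hasDerivAt_airyInt_zero {y : ℝ} (hy : 0 < y) :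
    HasDerivAt (airyInt 0) (-3 * airyInt 1 y) y := by
  refine (hasDerivAt_airyInt 0 hy).congr_deriv ?_
  rw [airyInt, ← integral_Ioi_comp_const_div _ hy, ← integral_const_mul]
  refine setIntegral_congr_fun measurableSet_Ioi fun v hv => ?_
  have hv : (0 : ℝ) < v := hv
  rw [show -(y / v) ^ 3 - y ^ 3 / (y / v) ^ 3 = -v ^ 3 - y ^ 3 / v ^ 3 by field_simp; ring]
  field_simp

lemma hasDerivAt_airyInt_one {y : ℝ} (hy : 0 < y) :
    HasDerivAt (airyInt 1) (-3 * (y * airyInt 0 y)) y := by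
  refine (hasDerivAt_airyInt 1 hy).congr_deriv ?_
  rw [airyInt, ← integral_Ioi_comp_const_div _ hy, ← integral_const_mul, ← integral_const_mul]
  refine setIntegral_congr_fun measurableSet_Ioi fun v hv => ?_
  have hv : (0 : ℝ) < v := hv
  rw [show -(y / v) ^ 3 - y ^ 3 / (y / v) ^ 3 = -v ^ 3 - y ^ 3 / v ^ 3 by field_simp; ring]
  field_simp

/-- Write y² = v²w² with w = y/v and use w² e^{-w³} ≤ 1. -/
lemma sq_mul_airyInt_le (m : ℕ) {y : ℝ} (hy : 0 < y) :
    y ^ 2 * airyInt m y ≤ airyInt (m + 2) 0 := by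
  rw [airyInt, airyInt, ← integral_const_mul]
  refine setIntegral_mono_on ((integrableOn_airyIntegrand m hy.le).const_mul _)
    (integrableOn_airyIntegrand (m + 2) le_rfl) measurableSet_Ioi fun v hv => ?_
  have hv : (0 : ℝ) < v := hv
  have h1 : (y / v) ^ 2 * Real.exp (-(y / v) ^ 3) ≤ 1 := by
    have hw : 0 < y / v := by positivity
    have h := Real.add_one_le_exp ((y / v) ^ 3)
    rw [Real.exp_neg, ← div_eq_mul_inv, div_le_one (Real.exp_pos _)]
    refine le_trans ?_ h
    nlinarith [sq_nonneg (y / v - 1), mul_nonneg hw.le (sq_nonneg (y / v - 1))]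
  calc y ^ 2 * (v ^ m * Real.exp (-v ^ 3 - y ^ 3 / v ^ 3))
      = v ^ (m + 2) * Real.exp (-v ^ 3) * ((y / v) ^ 2 * Real.exp (-(y / v) ^ 3)) := by
        rw [show -v ^ 3 - y ^ 3 / v ^ 3 = -v ^ 3 + -(y / v) ^ 3 by ring, Real.exp_add]
        field_simp
        ring
    _ ≤ v ^ (m + 2) * Real.exp (-v ^ 3) * 1 := by gcongr
    _ = _ := by norm_num

lemma tendsto_mul_airyInt_atTop (m : ℕ) : Tendsto (fun y => y * airyInt m y) atTop (𝓝 0) := by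
  refine squeeze_zero' (g := fun y => airyInt (m + 2) 0 / y) ?_ ?_
    (tendsto_const_nhds.div_atTop tendsto_id)
  · filter_upwards [eventually_gt_atTop 0] with y hy
    have := airyInt_pos m hy.le
    positivity
  · filter_upwards [eventually_gt_atTop 0] with y hy
    rw [le_div_iff₀ hy]
    have := sq_mul_airyInt_le m hy
    linarith

lemma eq_of_hasDerivAt_zero_of_tendsto {f : ℝ → ℝ} {l : ℝ}
    (hf : ∀ y, 0 < y → HasDerivAt f 0 y) (hl : Tendsto f (𝓝[>] 0) (𝓝 l)) {y : ℝ} (hy : 0 < y) :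
    f y = l := by
  have hconst : ∀ z ∈ Ioi (0 : ℝ), f z = f y := fun z hz =>
    isOpen_Ioi.is_const_of_deriv_eq_zero (convex_Ioi 0).isPreconnected
      (fun w hw => (hf w hw).differentiableAt.differentiableWithinAt)
      (fun w hw => (hf w hw).deriv) hz hy
  refine tendsto_nhds_unique (tendsto_const_nhds.congr' ?_) hl
  filter_upwards [self_mem_nhdsWithin] with z hz using (hconst z hz).symm

lemma airyA_zero : airyA 0 = 1 / Real.Gamma (2 / 3) := by
  norm_num [airyA, powerSum_zero, besselCoeff]

lemma airyADeriv_zero : airyADeriv 0 = -(3 / Real.Gamma (1 / 3)) := by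
  have h := Gamma_four_thirds
  norm_num [airyADeriv, cubicProfileDeriv, powerSum_zero, besselCoeff] at h ⊢
  rw [h]; field_simp

lemma tendsto_airyA_zero : Tendsto airyA (𝓝[>] 0) (𝓝 (1 / Real.Gamma (2 / 3))) := by
  rw [← airyA_zero]
  exact (hasDerivAt_airyA 0).continuousAt.tendsto.mono_left nhdsWithin_le_nhds

lemma tendsto_airyADeriv_zero :
    Tendsto airyADeriv (𝓝[>] 0) (𝓝 (-(3 / Real.Gamma (1 / 3)))) := by
  rw [← airyADeriv_zero]
  exact (hasDerivAt_airyADeriv 0).continuousAt.tendsto.mono_left nhdsWithin_le_nhds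

/-- This is the Wronskian A'J - AJ' with J = `airyInt 0` and J' = -3 `airyInt 1`. Both functions
solve f'' = 9yf, so it is constant, and its limit at 0 is 1 - 1 = 0. -/
lemma airy_wronskian {y : ℝ} (hy : 0 < y) :
    3 * airyA y * airyInt 1 y + airyADeriv y * airyInt 0 y = 0 := by
  have hg1 : Real.Gamma (1 / 3) ≠ 0 := (Real.Gamma_pos_of_pos (by norm_num)).ne'
  have hg2 : Real.Gamma (2 / 3) ≠ 0 := (Real.Gamma_pos_of_pos (by norm_num)).ne'
  have hlim := ((tendsto_airyA_zero.const_mul 3).mul (tendsto_airyInt_zero 1)).add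
    (tendsto_airyADeriv_zero.mul (tendsto_airyInt_zero 0))
  refine (eq_of_hasDerivAt_zero_of_tendsto (fun z hz => ?_) hlim hy).trans ?_
  · have := (((hasDerivAt_airyA z).const_mul 3).mul (hasDerivAt_airyInt_one hz)).add
      ((hasDerivAt_airyADeriv z).mul (hasDerivAt_airyInt_zero hz))
    refine this.congr_deriv ?_
    ring
  · rw [airyInt_zero, airyInt_zero]
    norm_num
    field_simp
    norm_num

/-- The ratio of `airyA` to `airyInt 0`. -/
noncomputable def airyRatio : ℝ := 3 / (Real.Gamma (1 / 3) * Real.Gamma (2 / 3))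

lemma airyRatio_pos : 0 < airyRatio := by
  have := Real.Gamma_pos_of_pos (show (0 : ℝ) < 1 / 3 by norm_num)
  have := Real.Gamma_pos_of_pos (show (0 : ℝ) < 2 / 3 by norm_num)
  rw [airyRatio]; positivity

/-- A vanishing Wronskian makes the quotient constant; the limit at 0 gives the constant. -/
lemma airyA_eq_airyInt {y : ℝ} (hy : 0 < y) : airyA y = airyRatio * airyInt 0 y := by
  have h0 := (airyInt_pos 0 hy.le).ne'
  have hlim := tendsto_airyA_zero.div (tendsto_airyInt_zero 0) (airyInt_pos 0 le_rfl).ne'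
  have key : airyA y / airyInt 0 y = 1 / Real.Gamma (2 / 3) / airyInt 0 0 := by
    refine eq_of_hasDerivAt_zero_of_tendsto (f := fun z => airyA z / airyInt 0 z) (fun z hz => ?_)
      hlim hy
    have := (hasDerivAt_airyA z).div (hasDerivAt_airyInt_zero hz) (airyInt_pos 0 hz.le).ne'
    refine this.congr_deriv ?_
    rw [show airyADeriv z * airyInt 0 z - airyA z * (-3 * airyInt 1 z) = 0 by
      linear_combination airy_wronskian hz, zero_div]
  rw [div_eq_iff h0] at key
  rw [key, airyInt_zero, airyRatio]
  norm_num
  left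
  field_simp

lemma airyADeriv_eq_airyInt {y : ℝ} (hy : 0 < y) :
    airyADeriv y = -3 * airyRatio * airyInt 1 y := by
  have h0 := (airyInt_pos 0 hy.le).ne'
  have h := airy_wronskian hy
  rw [airyA_eq_airyInt hy] at h
  refine mul_right_cancel₀ h0 ?_
  linear_combination h

lemma airyA_pos {y : ℝ} (hy : 0 < y) : 0 < airyA y := by
  rw [airyA_eq_airyInt hy]
  exact mul_pos airyRatio_pos (airyInt_pos 0 hy.le)

lemma tendsto_mul_airyA_atTop : Tendsto (fun y => y * airyA y) atTop (𝓝 0) := by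
  have h := (tendsto_mul_airyInt_atTop 0).const_mul airyRatio
  rw [mul_zero] at h
  refine h.congr' ?_
  filter_upwards [eventually_gt_atTop 0] with y hy
  rw [airyA_eq_airyInt hy]; ring

lemma tendsto_mul_airyADeriv_atTop : Tendsto (fun y => y * airyADeriv y) atTop (𝓝 0) := by
  have h := (tendsto_mul_airyInt_atTop 1).const_mul (-3 * airyRatio)
  rw [mul_zero] at h
  refine h.congr' ?_
  filter_upwards [eventually_gt_atTop 0] with y hy
  rw [airyADeriv_eq_airyInt hy]; ring

lemma tendsto_zero_of_mul_tendsto_zero {f : ℝ → ℝ}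
    (hf : Tendsto (fun y => y * f y) atTop (𝓝 0)) : Tendsto f atTop (𝓝 0) := by
  have h := hf.mul tendsto_inv_atTop_zero
  rw [mul_zero] at h
  refine h.congr' ?_
  filter_upwards [eventually_gt_atTop 0] with y hy
  field_simp

/-! ### The product integral and the subordination formula for u₃. -/

lemma airyA_mul_airyADeriv_zero :
    airyA 0 * airyADeriv 0 = -(3 * Real.sqrt 3 / (2 * Real.pi)) := by
  have hg1 : Real.Gamma (1 / 3) ≠ 0 := (Real.Gamma_pos_of_pos (by norm_num)).ne'
  have hg2 : Real.Gamma (2 / 3) ≠ 0 := (Real.Gamma_pos_of_pos (by norm_num)).ne'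
  have := Gamma_third_mul
  have e : airyA 0 * airyADeriv 0 = -(3 / (Real.Gamma (1 / 3) * Real.Gamma (2 / 3))) := by
    rw [airyA_zero, airyADeriv_zero]; field_simp
  have hpi := Real.pi_ne_zero
  rw [e, this]; field_simp

/-- An antiderivative of `r A(ar) A(br)` vanishing at infinity. -/
lemma exists_airyA_antideriv {a b : ℝ} (ha : 0 < a) (hb : 0 < b) :
    ∃ P : ℝ → ℝ, (∀ r, HasDerivAt P (r * airyA (a * r) * airyA (b * r)) r) ∧
      Tendsto P atTop (𝓝 0) ∧
      P 0 = airyA 0 * airyADeriv 0 / (9 * (a ^ 2 + a * b + b ^ 2)) := by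
  have hf : ∀ k r : ℝ, HasDerivAt (fun r => airyA (k * r)) (k * airyADeriv (k * r)) r := by
    intro k r
    have := (hasDerivAt_airyA (k * r)).comp r ((hasDerivAt_id' r).const_mul k)
    exact this.congr_deriv (by ring)
  have hf' : ∀ k r : ℝ, HasDerivAt (fun r => airyADeriv (k * r))
      (k * (9 * (k * r) * airyA (k * r))) r := by
    intro k r
    have := (hasDerivAt_airyADeriv (k * r)).comp r ((hasDerivAt_id' r).const_mul k)
    exact this.congr_deriv (by ring)
  have hk : ∀ {k : ℝ}, 0 < k → Tendsto (fun r : ℝ => k * r) atTop atTop := fun hk =>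
    tendsto_id.const_mul_atTop hk
  have hA := tendsto_zero_of_mul_tendsto_zero tendsto_mul_airyA_atTop
  have hA' := tendsto_zero_of_mul_tendsto_zero tendsto_mul_airyADeriv_atTop
  by_cases hab : a = b
  · subst hab
    -- By A'' = 9yA, the y-derivative of AA' - yA'² + 9y²A² is 27yA².
    refine ⟨fun r => 1 / (27 * a ^ 2) * (airyA (a * r) * airyADeriv (a * r)
      - (a * r) * (airyADeriv (a * r) * airyADeriv (a * r))
      + 9 * ((a * r) * airyA (a * r)) * ((a * r) * airyA (a * r))), fun r => ?_, ?_, ?_⟩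
    · have hr : HasDerivAt (fun r : ℝ => a * r) a r := by
        simpa using (hasDerivAt_id' r).const_mul a
      have := ((((hf a r).mul (hf' a r)).sub (hr.mul ((hf' a r).mul (hf' a r)))).add
        (((hr.mul (hf a r)).const_mul 9).mul (hr.mul (hf a r)))).const_mul (1 / (27 * a ^ 2))
      refine this.congr_deriv ?_
      field_simp
      simp only [Pi.mul_apply]
      ring
    · have h1 := ((hA.mul hA').sub (tendsto_mul_airyADeriv_atTop.mul hA')).add
        ((tendsto_mul_airyA_atTop.const_mul 9).mul tendsto_mul_airyA_atTop)
      have h2 := (h1.const_mul (1 / (27 * a ^ 2))).comp (hk ha)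
      simp only [mul_zero, sub_zero, add_zero] at h2
      refine h2.congr fun r => ?_
      simp only [Function.comp_apply]
      ring
    · simp only [mul_zero, zero_mul, sub_zero, add_zero]
      field_simp
      ring
  · have hne : a - b ≠ 0 := sub_ne_zero.2 hab
    have hq : 0 < a ^ 2 + a * b + b ^ 2 := by positivity
    -- By A'' = 9yA, the derivative of aA'(ar)A(br) - bA(ar)A'(br) is 9(a³ - b³) r A(ar)A(br).
    refine ⟨fun r => 1 / (9 * ((a - b) * (a ^ 2 + a * b + b ^ 2))) *
      (a * (airyADeriv (a * r) * airyA (b * r)) - b * (airyA (a * r) * airyADeriv (b * r))),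
      fun r => ?_, ?_, ?_⟩
    · have := ((((hf' a r).mul (hf b r)).const_mul a).sub
        (((hf a r).mul (hf' b r)).const_mul b)).const_mul
          (1 / (9 * ((a - b) * (a ^ 2 + a * b + b ^ 2))))
      refine this.congr_deriv ?_
      field_simp
      ring
    · have h1 := (((hA'.comp (hk ha)).mul (hA.comp (hk hb))).const_mul a).sub
        (((hA.comp (hk ha)).mul (hA'.comp (hk hb))).const_mul b)
      have h2 := h1.const_mul (1 / (9 * ((a - b) * (a ^ 2 + a * b + b ^ 2))))
      simpa using h2
    · simp only [mul_zero]
      field_simp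

theorem solU3_eq_integral {x t : ℝ} (hx : 0 < x) (ht : 0 < t) :
    IntegrableOn (fun s => solU1 x s * stableThird s t) (Ioi 0) ∧
      solU3 x t = ∫ s in Ioi (0 : ℝ), solU1 x s * stableThird s t := by
  obtain ⟨P, hP, hlim, hP0⟩ :=
    exists_airyA_antideriv (a := x / 3) (b := t / 3) (by positivity) (by positivity)
  set g : ℝ → ℝ := fun r => t * (r * airyA (x / 3 * r) * airyA (t / 3 * r)) with hg
  have hG : ∀ r ∈ Ici (0 : ℝ), HasDerivAt (fun r => t * P r) (g r) r := fun r _ =>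
    (hP r).const_mul t
  have hgpos : ∀ r ∈ Ioi (0 : ℝ), 0 ≤ g r := fun r hr => by
    have hr : 0 < r := hr
    have := airyA_pos (show 0 < x / 3 * r by positivity)
    have := airyA_pos (show 0 < t / 3 * r by positivity)
    simp only [hg]; positivity
  have hlim' : Tendsto (fun r => t * P r) atTop (𝓝 0) := by simpa using hlim.const_mul t
  -- Positivity of A enters here: a nonnegative derivative of a function with a finite limit is
  -- integrable.
  have hint := integrableOn_Ioi_deriv_of_nonneg' hG hgpos hlim'
  have hval := integral_Ioi_of_hasDerivAt_of_nonneg' hG hgpos hlim'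
  have hE : EqOn (fun s : ℝ => (|(-(1 / 3) : ℝ)| * s ^ (-(1 / 3) - 1 : ℝ)) •
      g (s ^ (-(1 / 3) : ℝ))) (fun s => solU1 x s * stableThird s t) (Ioi 0) := by
    intro s hs
    have hs : (0 : ℝ) < s := hs
    simp only [smul_eq_mul, hg]
    rw [stableThird_eq ht hs, solU1_eq hx hs, solU1_eq ht hs, rpow_sub_one_eq hs, abs_neg,
      abs_of_pos (by norm_num : (0 : ℝ) < 1 / 3)]
    field_simp
  constructor
  · rw [← integrableOn_Ioi_comp_rpow_iff _ (by norm_num : (-(1 / 3) : ℝ) ≠ 0)] at hint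
    exact hint.congr_fun hE measurableSet_Ioi
  · rw [← setIntegral_congr_fun measurableSet_Ioi hE,
      integral_comp_rpow_Ioi g (by norm_num : (-(1 / 3) : ℝ) ≠ 0), hval, hP0,
      airyA_mul_airyADeriv_zero, solU3]
    have e : (3 : ℝ) ^ (3 / 2 : ℝ) = 3 * Real.sqrt 3 := by
      rw [show (3 / 2 : ℝ) = 1 + 1 / 2 by norm_num, Real.rpow_add (by norm_num), Real.rpow_one,
        Real.sqrt_eq_rpow]
    have hpi := Real.pi_ne_zero
    have hq : x ^ 2 + x * t + t ^ 2 ≠ 0 := by positivity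
    rw [e, show (x / 3) ^ 2 + x / 3 * (t / 3) + (t / 3) ^ 2 = (x ^ 2 + x * t + t ^ 2) / 9 by ring]
    field_simp
    ring

/-! ### The rational solution u₃. -/

/-- With ω a primitive cube root of unity, the fraction is a multiple of 1/(x - ωt) - 1/(x - ω²t),
and any function of x - ωt has D_t³ = -ω³D_x³ = -D_x³. The check below stays real and lists the
successive derivatives explicitly. -/
lemma isClassicalSolution_const_mul_rational (C : ℝ) :
    IsClassicalSolution 3 1 (fun x t => C * (t / (x ^ 2 + x * t + t ^ 2))) := by
  have hq : ∀ {x t : ℝ}, 0 < x → 0 < t → x ^ 2 + x * t + t ^ 2 ≠ 0 := fun hx ht => by positivity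
  refine ⟨contDiffOn_const.mul (ContDiffOn.div contDiffOn_snd
    (ContDiff.contDiffOn (by fun_prop)) fun p hp => hq hp.1 hp.2), fun x t hx ht => ?_⟩
  have dt : ∀ τ : ℝ, HasDerivAt (fun τ => x ^ 2 + x * τ + τ ^ 2) (x + 2 * τ) τ := fun τ =>
    ((((hasDerivAt_id' τ).const_mul x).const_add (x ^ 2)).add (hasDerivAt_pow 2 τ)).congr_deriv
      (by norm_num)
  have dx : ∀ ξ : ℝ, HasDerivAt (fun ξ => ξ ^ 2 + ξ * t + t ^ 2) (2 * ξ + t) ξ := fun ξ =>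
    (((hasDerivAt_pow 2 ξ).add ((hasDerivAt_id' ξ).mul_const t)).add_const (t ^ 2)).congr_deriv
      (by norm_num)
  have ht3 := iteratedDeriv_three_eq_of_hasDerivAt
    (f := fun τ => C * (τ / (x ^ 2 + x * τ + τ ^ 2)))
    (f₁ := fun τ => C * ((x ^ 2 - τ ^ 2) / (x ^ 2 + x * τ + τ ^ 2) ^ 2))
    (f₂ := fun τ => C * ((2 * τ ^ 3 - 2 * x ^ 3 - 6 * x ^ 2 * τ) /
      (x ^ 2 + x * τ + τ ^ 2) ^ 3))
    (f₃ := fun τ => C * (((6 * τ ^ 2 - 6 * x ^ 2) * (x ^ 2 + x * τ + τ ^ 2) -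
      3 * (2 * τ ^ 3 - 2 * x ^ 3 - 6 * x ^ 2 * τ) * (x + 2 * τ)) / (x ^ 2 + x * τ + τ ^ 2) ^ 4))
    (fun τ hτ => by
      have h := hq hx hτ
      refine (((hasDerivAt_id' τ).div (dt τ) h).const_mul C).congr_deriv ?_
      field_simp; ring)
    (fun τ hτ => by
      have h := hq hx hτ
      refine ((((hasDerivAt_pow 2 τ).const_sub (x ^ 2)).div ((dt τ).pow 2)
        (pow_ne_zero 2 h)).const_mul C).congr_deriv ?_
      simp only [Pi.pow_apply]
      field_simp; norm_num; ring)
    (fun τ hτ => by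
      have h := hq hx hτ
      refine ((((((hasDerivAt_pow 3 τ).const_mul 2).sub_const (2 * x ^ 3)).sub
        ((hasDerivAt_id' τ).const_mul (6 * x ^ 2))).div ((dt τ).pow 3)
        (pow_ne_zero 3 h)).const_mul C).congr_deriv ?_
      simp only [Pi.pow_apply, Pi.sub_apply]
      field_simp; norm_num; ring) ht
  have hx3 := iteratedDeriv_three_eq_of_hasDerivAt
    (f := fun ξ => C * (t / (ξ ^ 2 + ξ * t + t ^ 2)))
    (f₁ := fun ξ => C * ((-t * (2 * ξ + t)) / (ξ ^ 2 + ξ * t + t ^ 2) ^ 2))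
    (f₂ := fun ξ => C * ((6 * t * ξ ^ 2 + 6 * t ^ 2 * ξ) / (ξ ^ 2 + ξ * t + t ^ 2) ^ 3))
    (f₃ := fun ξ => C * (((12 * t * ξ + 6 * t ^ 2) * (ξ ^ 2 + ξ * t + t ^ 2) -
      3 * (6 * t * ξ ^ 2 + 6 * t ^ 2 * ξ) * (2 * ξ + t)) / (ξ ^ 2 + ξ * t + t ^ 2) ^ 4))
    (fun ξ hξ => by
      have h := hq hξ ht
      refine (((hasDerivAt_const ξ t).div (dx ξ) h).const_mul C).congr_deriv ?_
      field_simp; ring)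
    (fun ξ hξ => by
      have h := hq hξ ht
      refine ((((((hasDerivAt_id' ξ).const_mul 2).add_const t).const_mul (-t)).div
        ((dx ξ).pow 2) (pow_ne_zero 2 h)).const_mul C).congr_deriv ?_
      simp only [Pi.pow_apply]
      field_simp; norm_num; ring)
    (fun ξ hξ => by
      have h := hq hξ ht
      refine (((((hasDerivAt_pow 2 ξ).const_mul (6 * t)).add
        ((hasDerivAt_id' ξ).const_mul (6 * t ^ 2))).div ((dx ξ).pow 3)
        (pow_ne_zero 3 h)).const_mul C).congr_deriv ?_
      simp only [Pi.pow_apply, Pi.add_apply]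
      field_simp; norm_num; ring) hx
  rw [ht3, hx3]
  have h := hq hx ht
  field_simp
  ring

theorem solU3_eq_of_ne {x t : ℝ} (hx : 0 < x) (ht : 0 < t) (hne : x ≠ t) :
    solU3 x t = 3 ^ (3 / 2 : ℝ) * t / (2 * Real.pi) * ((x - t) / (x ^ 3 - t ^ 3)) := by
  have h := sub_ne_zero.2 hne
  have hq : x ^ 2 + x * t + t ^ 2 ≠ 0 := by positivity
  have hpi := Real.pi_ne_zero
  rw [solU3, show x ^ 3 - t ^ 3 = (x - t) * (x ^ 2 + x * t + t ^ 2) by ring]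
  field_simp
theorem mainTheorem7 :
    IsClassicalSolution 1 1 solU1 ∧
    (IsClassicalSolution 2 (-1) solU2 ∧
      ∀ x t : ℝ, 0 < x → 0 < t →
        IntegrableOn (fun s => solU1 x s * stableHalf s t) (Ioi 0) ∧
        solU2 x t = ∫ s in Ioi (0 : ℝ), solU1 x s * stableHalf s t) ∧
    (IsClassicalSolution 3 1 solU3 ∧
      IsClassicalSolution 3 1
        (fun x t => 2 / (3 ^ (3 / 2 : ℝ) * Real.pi) * (t / (x ^ 2 + x * t + t ^ 2))) ∧
      ∀ x t : ℝ, 0 < x → 0 < t →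
        IntegrableOn (fun s => solU1 x s * stableThird s t) (Ioi 0) ∧
        solU3 x t = (∫ s in Ioi (0 : ℝ), solU1 x s * stableThird s t) ∧
        (x ≠ t →
          solU3 x t = 3 ^ (3 / 2 : ℝ) * t / (2 * Real.pi) * ((x - t) / (x ^ 3 - t ^ 3)))) := by
  refine ⟨isClassicalSolution_solU1, ⟨isClassicalSolution_solU2, fun x t hx ht =>
    solU2_eq_integral hx ht⟩, isClassicalSolution_const_mul_rational _,
    isClassicalSolution_const_mul_rational _, fun x t hx ht => ?_⟩
  obtain ⟨hint, hval⟩ := solU3_eq_integral hx ht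
  exact ⟨hint, hval, fun hne => solU3_eq_of_ne hx ht hne⟩
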